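/- **Theorem (K-FAC).** Let $\phi(z)=\max(z,0)$, with the convention $\phi'(z)=\mathbb I\{z\ge 0\}$. Let $\mathbf X\in\mathbb R^{n\times d}$ ($n\ge1$) have rows $\mathbf x_1^\top,\dots,\mathbf x_n^\top$, and let $\mathbf y\in\mathbb R^n$. For first-layer weights $\mathbf w=(\mathbf w_1,\dots,\mathbf w_m)\in(\mathbb R^d)^m$ and output weights $a\in\{-1,1\}^m$ consider the two-layer network with outputs $$\mathbf u_i(\mathbf w)=\frac1{\sqrt m}\sum_{r=1}^m a_r\,\phi(\mathbf w_r^\top\mathbf x_i),\qquad 1\le i\le n,$$ the matrix $\mathbf S(\mathbf w)\in\mathbb R^{n\times m}$ of derivatives of the outputs with respect to the pre-activations, $\mathbf S_{ir}=\frac1{\sqrt m}a_r\phi'(\mathbf w_r^\top\mathbf x_i)$, and the Jacobian $\mathbf J(\mathbf w)\in\mathbb R^{n\times dm}$ with respect to the first-layer weights, whose entry in row $i$ and in the column of the $j$-th coordinate of $\mathbf w_r$ is $\mathbf S_{ir}\mathbf X_{ij}$ (columns ordered as in $\mathbb R^d\otimes\mathbb R^m$). The K-FAC iteration with step size $\eta$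 trains the first layer only: $$\mathbf w(k+1)=\mathbf w(k)-\eta\left[(\mathbf X^\top\mathbf X)^{-1}\otimes(\mathbf S(k)^\top\mathbf S(k))^{\dagger}\right]\mathbf J(k)^\top(\mathbf u(k)-\mathbf y),$$ where $\dagger$ is the Moore–Penrose inverse and $\mathbf S(k),\mathbf J(k),\mathbf u(k)$ are evaluated at $\mathbf w(k)$. Let $\lambda_{\mathbf S}$ be the smallest eigenvalue of the $n\times n$ matrix with entries $\mathbb E_{\mathbf w\sim\mathcal N(\mathbf 0,\nu^2\mathbf I_d)}[\phi'(\mathbf w^\top\mathbf x_i)\phi'(\mathbf w^\top\mathbf x_j)]$, and let $\kappa=\lambda_{\max}(\mathbf X^\top\mathbf X)/\lambda_{\min}(\mathbf X^\top\mathbf X)$. There is an absolute constant $c>0$, and for all $B,\nu_0>0$ there is a constant $C>0$ depending only on $B$ and $\nu_0$, such that the following holds. Suppose that $\|\mathbf x_i\|_2=1$ and $|y_i|\le B$ for all $i$, that no $\mathbf x_i$ is a multiple of $\mathbf x_j$ for $i\ne j$, that $\operatorname{rank}(\mathbf X)=d$, and that $0<\nu\le\nu_0$ and $0<\delta<1$.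 Initialize independently $\mathbf w_r(0)\sim\mathcal N(\mathbf 0,\nu^2\mathbf I_d)$ and $a_r\sim\mathrm{unif}\{-1,+1\}$, $1\le r\le m$. If $$m\ \ge\ C\,\frac{n^4\,\kappa^4}{\nu^2\,\lambda_{\mathbf S}^4\,\delta^3}\qquad\text{and}\qquad 0<\eta\le c\,\lambda_{\min}(\mathbf X^\top\mathbf X),$$ then with probability at least $1-\delta$ over the initialization, for all $k=0,1,2,\dots$, $$\|\mathbf u(k)-\mathbf y\|_2^2\le\left(1-\frac{\eta}{\lambda_{\max}(\mathbf X^\top\mathbf X)}\right)^k\|\mathbf u(0)-\mathbf y\|_2^2 .$$ -/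

import Mathlib

open MeasureTheory ProbabilityTheory
open scoped Matrix Kronecker

namespace KFAC

/-! ### Linear algebra -/

/-- Smallest eigenvalue of a real symmetric matrix. -/
noncomputable def lambdaMin {ι : Type*} [Fintype ι] [DecidableEq ι] (A : Matrix ι ι ℝ) : ℝ :=
  sInf (spectrum ℝ A)

/-- Largest eigenvalue of a real symmetric matrix. -/
noncomputable def lambdaMax {ι : Type*} [Fintype ι] [DecidableEq ι] (A : Matrix ι ι ℝ) : ℝ :=
  sSup (spectrum ℝ A)

/-- Condition number of a positive definite matrix. -/
noncomputable def conditionNumber {ι : Type*} [Fintype ι] [DecidableEq ι]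
    (A : Matrix ι ι ℝ) : ℝ :=
  lambdaMax A / lambdaMin A

/-- The four Penrose equations: `B` is the Moore-Penrose inverse of the real matrix `A`. -/
structure IsMoorePenrose {ι κ : Type*} [Fintype ι] [Fintype κ]
    (A : Matrix ι κ ℝ) (B : Matrix κ ι ℝ) : Prop where
  mul_mul_left : A * B * A = A
  mul_mul_right : B * A * B = B
  symm_left : (A * B)ᵀ = A * B
  symm_right : (B * A)ᵀ = B * A

theorem IsMoorePenrose.unique {ι κ : Type*} [Fintype ι] [Fintype κ]
    {A : Matrix ι κ ℝ} {B C : Matrix κ ι ℝ}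
    (hB : IsMoorePenrose A B) (hC : IsMoorePenrose A C) : B = C := by
  have h1 : A * B = A * C := by
    calc A * B = (A * C * A) * B := by rw [hC.mul_mul_left]
      _ = (A * C) * (A * B) := by simp only [Matrix.mul_assoc]
      _ = (A * C)ᵀ * (A * B)ᵀ := by rw [hC.symm_left, hB.symm_left]
      _ = ((A * B) * (A * C))ᵀ := by rw [← Matrix.transpose_mul]
      _ = ((A * B * A) * C)ᵀ := by simp only [Matrix.mul_assoc]
      _ = A * C := by rw [hB.mul_mul_left, hC.symm_left]
  have h2 : B * A = C * A := by
    calc B * A = B * (A * C * A) := by rw [hC.mul_mul_left]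
      _ = (B * A) * (C * A) := by simp only [Matrix.mul_assoc]
      _ = (B * A)ᵀ * (C * A)ᵀ := by rw [hC.symm_right, hB.symm_right]
      _ = ((C * A) * (B * A))ᵀ := by rw [← Matrix.transpose_mul]
      _ = (C * (A * B * A))ᵀ := by simp only [Matrix.mul_assoc]
      _ = C * A := by rw [hB.mul_mul_left, hC.symm_right]
  calc B = B * A * B := hB.mul_mul_right.symm
    _ = C * A * B := by rw [h2]
    _ = C * (A * B) := Matrix.mul_assoc _ _ _
    _ = C * (A * C) := by rw [h1]
    _ = C * A * C := (Matrix.mul_assoc _ _ _).symm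
    _ = C := hC.mul_mul_right

/-- A real symmetric matrix has a Moore-Penrose inverse. -/
theorem exists_isMoorePenrose {ι : Type*} [Fintype ι] [DecidableEq ι] {A : Matrix ι ι ℝ}
    (hA : A.IsHermitian) : ∃ B, IsMoorePenrose A B := by
  let D : (ι → ℝ) → Matrix ι ι ℝ := Matrix.diagonal
  obtain ⟨U, e, hU, hAeq⟩ : ∃ (U : Matrix ι ι ℝ) (e : ι → ℝ), Uᵀ * U = 1 ∧ A = U * D e * Uᵀ := by
    refine ⟨(hA.eigenvectorUnitary : Matrix ι ι ℝ), hA.eigenvalues, ?_, ?_⟩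
    · have := Unitary.coe_star_mul_self hA.eigenvectorUnitary
      simpa [Matrix.star_eq_conjTranspose, Matrix.conjTranspose_eq_transpose_of_trivial] using this
    · have := hA.spectral_theorem
      rw [Unitary.conjStarAlgAut_apply] at this
      simpa [Matrix.star_eq_conjTranspose, Matrix.conjTranspose_eq_transpose_of_trivial, D,
        Function.comp_def] using this
  have hmul : ∀ f g : ι → ℝ, (U * D f * Uᵀ) * (U * D g * Uᵀ) = U * D (fun i => f i * g i) * Uᵀ := by
    intro f g
    calc (U * D f * Uᵀ) * (U * D g * Uᵀ) = U * D f * (Uᵀ * U) * D g * Uᵀ := by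
          simp only [Matrix.mul_assoc]
      _ = U * (D f * D g) * Uᵀ := by rw [hU, Matrix.mul_one]; simp only [Matrix.mul_assoc]
      _ = _ := by simp only [D, Matrix.diagonal_mul_diagonal]
  have hsymm : ∀ f : ι → ℝ, (U * D f * Uᵀ)ᵀ = U * D f * Uᵀ := by
    intro f
    simp [D, Matrix.transpose_mul, Matrix.mul_assoc]
  refine ⟨U * D (fun i => (e i)⁻¹) * Uᵀ, ?_, ?_, ?_, ?_⟩
  · rw [hAeq, hmul, hmul]
    congr 3
    funext i
    by_cases h : e i = 0
    · simp [h]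
    · field_simp
  · rw [hAeq, hmul, hmul]
    congr 3
    funext i
    by_cases h : e i = 0
    · simp [h]
    · field_simp
  · rw [hAeq, hmul, hsymm]
  · rw [hAeq, hmul, hsymm]

open Classical in
/-- The Moore-Penrose inverse. -/
noncomputable def pinv {ι κ : Type*} [Fintype ι] [Fintype κ]
    (A : Matrix ι κ ℝ) : Matrix κ ι ℝ :=
  if h : ∃ B, IsMoorePenrose A B then h.choose else 0

theorem IsMoorePenrose.pinv_eq {ι κ : Type*} [Fintype ι] [Fintype κ]
    {A : Matrix ι κ ℝ} {B : Matrix κ ι ℝ} (hB : IsMoorePenrose A B) : pinv A = B := by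
  have h : ∃ B, IsMoorePenrose A B := ⟨B, hB⟩
  rw [pinv, dif_pos h]
  exact h.choose_spec.unique hB

theorem pinv_spec {ι : Type*} [Fintype ι] [DecidableEq ι] {A : Matrix ι ι ℝ}
    (hA : A.IsHermitian) : IsMoorePenrose A (pinv A) := by
  obtain ⟨B, hB⟩ := exists_isMoorePenrose hA
  rwa [hB.pinv_eq]

/-! ### The two-layer ReLU network

`X i` is the `i`-th input vector, `w r` the input weights and `a r` the output weight of the
hidden unit `r`. -/

/-- The rectified linear unit. -/
noncomputable def relu (z : ℝ) : ℝ := max z 0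

/-- The derivative of the rectified linear unit, with the convention that it is `1` at `0`. -/
noncomputable def reluDeriv (z : ℝ) : ℝ := if 0 ≤ z then 1 else 0

/-- Network outputs on the whole data set. -/
noncomputable def output {n d m : ℕ} (X : Matrix (Fin n) (Fin d) ℝ) (a : Fin m → ℝ)
    (w : Fin m → Fin d → ℝ) : Fin n → ℝ :=
  fun i => 1 / √(m : ℝ) * ∑ r, a r * relu (w r ⬝ᵥ X i)

/-- Derivatives of the outputs with respect to the pre-activations of the hidden units. -/
noncomputable def preactDeriv {n d m : ℕ} (X : Matrix (Fin n) (Fin d) ℝ) (a : Fin m → ℝ)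
    (w : Fin m → Fin d → ℝ) : Matrix (Fin n) (Fin m) ℝ :=
  Matrix.of fun i r => 1 / √(m : ℝ) * (a r * reluDeriv (w r ⬝ᵥ X i))

/-- Jacobian of the outputs with respect to the first-layer weights; the column `(j, r)` belongs
to the `j`-th coordinate of `w r`. -/
noncomputable def jacobian {n d m : ℕ} (X : Matrix (Fin n) (Fin d) ℝ) (a : Fin m → ℝ)
    (w : Fin m → Fin d → ℝ) : Matrix (Fin n) (Fin d × Fin m) ℝ :=
  Matrix.of fun i p => 1 / √(m : ℝ) * (a p.2 * reluDeriv (w p.2 ⬝ᵥ X i) * X i p.1)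

/-- The inverse K-FAC preconditioner `(XᵀX)⁻¹ ⊗ (SᵀS)⁻¹`; the `m × m` matrix `SᵀS` is singular as
soon as `n < m`, so its inverse is the generalized one. -/
noncomputable def kfacInv {n d m : ℕ} (X : Matrix (Fin n) (Fin d) ℝ) (a : Fin m → ℝ)
    (w : Fin m → Fin d → ℝ) : Matrix (Fin d × Fin m) (Fin d × Fin m) ℝ :=
  (Xᵀ * X)⁻¹ ⊗ₖ pinv ((preactDeriv X a w)ᵀ * preactDeriv X a w)

/-- One K-FAC step with step size `η`. -/
noncomputable def kfacStep {n d m : ℕ} (X : Matrix (Fin n) (Fin d) ℝ) (y : Fin n → ℝ)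
    (a : Fin m → ℝ) (η : ℝ) (w : Fin m → Fin d → ℝ) : Fin m → Fin d → ℝ :=
  fun r j => w r j -
    η * (kfacInv X a w *ᵥ ((jacobian X a w)ᵀ *ᵥ (output X a w - y))) (j, r)

/-- The first-layer weights after `k` K-FAC steps from the initial weights `w₀`. -/
noncomputable def kfacIter {n d m : ℕ} (X : Matrix (Fin n) (Fin d) ℝ) (y : Fin n → ℝ)
    (a : Fin m → ℝ) (η : ℝ) (w₀ : Fin m → Fin d → ℝ) : ℕ → Fin m → Fin d → ℝ
  | 0 => w₀
  | k + 1 => kfacStep X y a η (kfacIter X y a η w₀ k)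

/-! ### Random initialization -/

/-- The Gaussian law `N(0, ν² I)` on `ℝ^d`. -/
noncomputable def gaussianVec (d : ℕ) (ν : ℝ) : Measure (Fin d → ℝ) :=
  Measure.pi fun _ => gaussianReal 0 ⟨ν ^ 2, sq_nonneg ν⟩

/-- The law of the initialization `(w, a)`: all `w r` are `N(0, ν² I)`, all `a r` are uniform on
`{-1, 1}`, and everything is independent. -/
noncomputable def initLaw (m d : ℕ) (ν : ℝ) :
    Measure ((Fin m → Fin d → ℝ) × (Fin m → ℝ)) :=
  (Measure.pi fun _ => gaussianVec d ν).prod (Measure.pi fun _ => uniformOn {-1, 1})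

/-- The infinite-width limit of `S Sᵀ`, where `S` is the matrix of pre-activation derivatives:
its entries are `E[φ'(wᵀxᵢ) φ'(wᵀxⱼ)] = E[1{wᵀxᵢ ≥ 0, wᵀxⱼ ≥ 0}]` for `w ∼ N(0, ν² I)`. -/
noncomputable def limitGramS {n d : ℕ} (X : Matrix (Fin n) (Fin d) ℝ) (ν : ℝ) :
    Matrix (Fin n) (Fin n) ℝ :=
  Matrix.of fun i j => ∫ w, reluDeriv (w ⬝ᵥ X i) * reluDeriv (w ⬝ᵥ X j) ∂(gaussianVec d ν)

end KFAC

/-!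
# Convergence of K-FAC for wide two-layer ReLU networks

Write `M = XᵀX` with extreme eigenvalues `l ≤ L`, `P = X M⁻¹ Xᵀ` for the projection onto the column
space of `X`, `S` for the matrix of pre-activation derivatives and `e` for the residual.

When `S` has full row rank, `(SᵀS)† Sᵀ = Sᵀ (SSᵀ)⁻¹` (`pinv_mul_transpose`), so a K-FAC step
changes the pre-activations by `-η P diag(e) (SSᵀ)⁻¹ S` (`kfacStep_dotProduct`). To first order the
residual `e i` is therefore multiplied by `1 - η P i i` (`sum_mul_preactMove`), and
`1 / L ≤ P i i ≤ 1 / l` because the inputs are unit vectors. The linearization errs only at hidden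
units whose activation flips. If few do, the squared residual drops by `η q`, where
`q = ∑ j, P j j * e j ^ 2 ≥ ‖e‖² / L` (`residual_kfacStep_le`).

The pre-activations move by at most `η √q` divided by the least singular value of `S`. Since a drop
of `η q` in `‖e‖²` is a drop of at least `η √q / (2 √L)` in `‖e‖` (`step_le_mul_sub`), the length of
the whole trajectory is at most a multiple of the initial residual, and the sum of the distance from
the start and of this multiple of `‖e‖` is nonincreasing. In `kfacIter_converges` this potential
confines the iteration to a ball, in which `flipRate_le` bounds the number of flips: a unit flips
only if its initial pre-activation is small or its pre-activation moves far. The number of flips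
is also the squared Frobenius distance of `S` to its initial value, up to the factor `m`, so it
controls the least singular value of `S` as well (`preactDeriv_gram_lower_bound`).

Three random quantities are controlled at the start, each by Markov's inequality: the number of
small pre-activations (`integral_nearCount_le`), the residual (`integral_residual_le`) and the
distance of `SSᵀ` to its mean (`integral_sum_empGram_sub_sq_le`). Finally the bound on the width is
meaningful because the limit Gram matrix is positive definite: the functions `w ↦ φ'(wᵀxᵢ)` jump
across pairwise distinct hyperplanes (`dotProduct_limitGramS_pos`).
-/

namespace KFAC

/-! ### Extreme eigenvalues of symmetric matrices -/

section Eigenvalues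

variable {ι κ : Type*} [Fintype κ]

theorem isHermitian_transpose_mul_self (A : Matrix κ ι ℝ) : (Aᵀ * A).IsHermitian := by
  simpa using Matrix.isHermitian_conjTranspose_mul_self A

variable [Fintype ι]

theorem dotProduct_transpose_mul_mulVec (A : Matrix κ ι ℝ) (u v : ι → ℝ) :
    u ⬝ᵥ ((Aᵀ * A) *ᵥ v) = (A *ᵥ u) ⬝ᵥ (A *ᵥ v) := by
  rw [← Matrix.mulVec_mulVec, Matrix.dotProduct_mulVec, Matrix.vecMul_transpose]

theorem dotProduct_self_eq_sum_sq (v : ι → ℝ) : v ⬝ᵥ v = ∑ i, v i ^ 2 := by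
  simp [dotProduct, sq]

theorem dotProduct_self_nonneg' (v : ι → ℝ) : 0 ≤ v ⬝ᵥ v := by
  rw [dotProduct_self_eq_sum_sq]; positivity

theorem dotProduct_self_pos' {v : ι → ℝ} (hv : v ≠ 0) : 0 < v ⬝ᵥ v :=
  (dotProduct_self_nonneg' v).lt_of_ne' (by simpa using hv)

theorem dotProduct_sq_le (u v : ι → ℝ) : (u ⬝ᵥ v) ^ 2 ≤ (u ⬝ᵥ u) * (v ⬝ᵥ v) := by
  rw [dotProduct_self_eq_sum_sq, dotProduct_self_eq_sum_sq]
  exact Finset.sum_mul_sq_le_sq_mul_sq _ _ _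

theorem norm_toLp_sq (v : ι → ℝ) : ‖WithLp.toLp 2 v‖ ^ 2 = v ⬝ᵥ v := by
  rw [EuclideanSpace.real_norm_sq_eq, dotProduct_self_eq_sum_sq]

variable [DecidableEq ι] {A : Matrix ι ι ℝ}

theorem finite_spectrum (hA : A.IsHermitian) : (spectrum ℝ A).Finite := by
  rw [hA.spectrum_real_eq_range_eigenvalues]; exact Set.finite_range _

theorem lambdaMin_mul_le (hA : A.IsHermitian) (v : ι → ℝ) :
    lambdaMin A * (v ⬝ᵥ v) ≤ v ⬝ᵥ (A *ᵥ v) := by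
  have h : (A - algebraMap ℝ (Matrix ι ι ℝ) (lambdaMin A)).PosSemidef := by
    rw [Matrix.posSemidef_iff_isHermitian_and_spectrum_nonneg]
    refine ⟨hA.sub (by simp [Matrix.algebraMap_eq_diagonal, Matrix.IsHermitian]), ?_⟩
    rw [← spectrum.sub_singleton_eq]
    rintro _ ⟨x, hx, _, rfl, rfl⟩
    exact sub_nonneg.2 (csInf_le (finite_spectrum hA).bddBelow hx)
  have := h.dotProduct_mulVec_nonneg v
  simp only [Matrix.sub_mulVec, star_trivial, dotProduct_sub, Algebra.algebraMap_eq_smul_one,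
    Matrix.smul_mulVec, Matrix.one_mulVec, dotProduct_smul, smul_eq_mul] at this
  linarith

theorem le_lambdaMax_mul (hA : A.IsHermitian) (v : ι → ℝ) :
    v ⬝ᵥ (A *ᵥ v) ≤ lambdaMax A * (v ⬝ᵥ v) := by
  have h : (algebraMap ℝ (Matrix ι ι ℝ) (lambdaMax A) - A).PosSemidef := by
    rw [Matrix.posSemidef_iff_isHermitian_and_spectrum_nonneg]
    refine ⟨Matrix.IsHermitian.sub (by simp [Matrix.algebraMap_eq_diagonal, Matrix.IsHermitian]) hA,
      ?_⟩
    rw [← spectrum.singleton_sub_eq]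
    rintro _ ⟨_, rfl, x, hx, rfl⟩
    exact sub_nonneg.2 (le_csSup (finite_spectrum hA).bddAbove hx)
  have := h.dotProduct_mulVec_nonneg v
  simp only [Matrix.sub_mulVec, star_trivial, dotProduct_sub, Algebra.algebraMap_eq_smul_one,
    Matrix.smul_mulVec, Matrix.one_mulVec, dotProduct_smul, smul_eq_mul] at this
  linarith

theorem exists_eigenvector_of_mem_spectrum {x : ℝ} (hx : x ∈ spectrum ℝ A) :
    ∃ v : ι → ℝ, v ≠ 0 ∧ A *ᵥ v = x • v := by
  rw [← Matrix.spectrum_toLin', ← Module.End.hasEigenvalue_iff_mem_spectrum] at hx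
  obtain ⟨v, hv⟩ := hx.exists_hasEigenvector
  exact ⟨v, hv.2, by simpa using hv.apply_eq_smul⟩

theorem nonempty_spectrum [Nonempty ι] (hA : A.IsHermitian) : (spectrum ℝ A).Nonempty := by
  rw [hA.spectrum_real_eq_range_eigenvalues]; exact Set.range_nonempty _

theorem exists_eigenvector_lambdaMin [Nonempty ι] (hA : A.IsHermitian) :
    ∃ v : ι → ℝ, v ≠ 0 ∧ A *ᵥ v = lambdaMin A • v :=
  exists_eigenvector_of_mem_spectrum ((nonempty_spectrum hA).csInf_mem (finite_spectrum hA))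

theorem exists_eigenvector_lambdaMax [Nonempty ι] (hA : A.IsHermitian) :
    ∃ v : ι → ℝ, v ≠ 0 ∧ A *ᵥ v = lambdaMax A • v :=
  exists_eigenvector_of_mem_spectrum ((nonempty_spectrum hA).csSup_mem (finite_spectrum hA))

theorem lambdaMin_pos [Nonempty ι] (hA : A.IsHermitian)
    (h : ∀ v, v ≠ 0 → 0 < v ⬝ᵥ (A *ᵥ v)) : 0 < lambdaMin A := by
  obtain ⟨v, hv, hAv⟩ := exists_eigenvector_lambdaMin hA
  have := h v hv
  rw [hAv, dotProduct_smul, smul_eq_mul] at this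
  exact pos_of_mul_pos_left this (dotProduct_self_nonneg' v)

theorem lambdaMin_le_lambdaMax [Nonempty ι] (hA : A.IsHermitian) : lambdaMin A ≤ lambdaMax A :=
  csInf_le_csSup (nonempty_spectrum hA) (finite_spectrum hA).bddBelow (finite_spectrum hA).bddAbove

theorem lambdaMax_le [Nonempty ι] (hA : A.IsHermitian) {c : ℝ}
    (h : ∀ v, v ⬝ᵥ (A *ᵥ v) ≤ c * (v ⬝ᵥ v)) : lambdaMax A ≤ c := by
  obtain ⟨v, hv, hAv⟩ := exists_eigenvector_lambdaMax hA
  have := h v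
  rw [hAv, dotProduct_smul, smul_eq_mul] at this
  exact le_of_mul_le_mul_right this (dotProduct_self_pos' hv)

/-- If `A ≥ σ > 0` then `A⁻¹ ≤ σ⁻¹`, in terms of quadratic forms. The lower bound on `A` also makes
it invertible. -/
theorem dotProduct_inv_mulVec_le {σ : ℝ} (hσ : 0 < σ)
    (h : ∀ v, σ * (v ⬝ᵥ v) ≤ v ⬝ᵥ (A *ᵥ v)) :
    IsUnit A.det ∧ ∀ y, y ⬝ᵥ (A⁻¹ *ᵥ y) ≤ (y ⬝ᵥ y) / σ := by
  have hu : IsUnit A.det := by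
    rw [← Matrix.isUnit_iff_isUnit_det, ← Matrix.mulVec_injective_iff_isUnit]
    rw [← Matrix.coe_mulVecLin, injective_iff_map_eq_zero]
    intro v hv
    by_contra hne
    have := h v
    rw [Matrix.mulVecLin_apply] at hv
    rw [hv, dotProduct_zero] at this
    nlinarith [dotProduct_self_pos' hne]
  refine ⟨hu, fun y => ?_⟩
  set z := A⁻¹ *ᵥ y with hz
  have hy : A *ᵥ z = y := by
    rw [hz, Matrix.mulVec_mulVec, Matrix.mul_nonsing_inv _ hu, Matrix.one_mulVec]
  have h1 := h z
  rw [hy, dotProduct_comm] at h1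
  have h2 := dotProduct_sq_le y z
  rw [le_div_iff₀ hσ]
  rcases (dotProduct_self_nonneg' z).eq_or_lt with h0 | h0
  · have : z = 0 := by simpa using h0.symm
    rw [this]; simpa using dotProduct_self_nonneg' y
  have hyz : z ⬝ᵥ z * σ ≤ y ⬝ᵥ z := by rw [dotProduct_comm y z, dotProduct_comm z y] at *; linarith
  have hpos : 0 < y ⬝ᵥ z := lt_of_lt_of_le (by positivity) hyz
  have : y ⬝ᵥ z * (y ⬝ᵥ z * σ) ≤ y ⬝ᵥ z * (y ⬝ᵥ y) := by
    nlinarith [mul_le_mul_of_nonneg_left hyz (dotProduct_self_nonneg' y)]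
  exact le_of_mul_le_mul_left this hpos

end Eigenvalues

/-! ### The projection onto the column space of the data matrix -/

section HatMatrix

variable {n d : ℕ} {X : Matrix (Fin n) (Fin d) ℝ}

/-- The orthogonal projection `X (XᵀX)⁻¹ Xᵀ` onto the column space of `X` (the hat matrix of least
squares); it is meaningful when `XᵀX` is invertible. -/
noncomputable def hatMatrix (X : Matrix (Fin n) (Fin d) ℝ) : Matrix (Fin n) (Fin n) ℝ :=
  X * (Xᵀ * X)⁻¹ * Xᵀ

theorem hatMatrix_transpose (X : Matrix (Fin n) (Fin d) ℝ) : (hatMatrix X)ᵀ = hatMatrix X := by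
  simp [hatMatrix, Matrix.transpose_mul, Matrix.transpose_nonsing_inv, Matrix.mul_assoc]

theorem hatMatrix_symm (X : Matrix (Fin n) (Fin d) ℝ) (i j : Fin n) :
    hatMatrix X i j = hatMatrix X j i := by
  conv_lhs => rw [← hatMatrix_transpose X, Matrix.transpose_apply]

theorem hatMatrix_mul_self (hX : IsUnit (Xᵀ * X).det) :
    hatMatrix X * hatMatrix X = hatMatrix X := by
  calc hatMatrix X * hatMatrix X = X * ((Xᵀ * X)⁻¹ * (Xᵀ * X)) * (Xᵀ * X)⁻¹ * Xᵀ := by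
        simp only [hatMatrix, Matrix.mul_assoc]
    _ = hatMatrix X := by rw [Matrix.nonsing_inv_mul _ hX, Matrix.mul_one, hatMatrix]

theorem sum_hatMatrix_mul (hX : IsUnit (Xᵀ * X).det) (i j : Fin n) :
    ∑ k, hatMatrix X k i * hatMatrix X k j = hatMatrix X i j := by
  conv_rhs => rw [← hatMatrix_mul_self hX, Matrix.mul_apply]
  exact Finset.sum_congr rfl fun k _ => by rw [hatMatrix_symm X k i]

theorem hatMatrix_diag_nonneg (hX : IsUnit (Xᵀ * X).det) (i : Fin n) : 0 ≤ hatMatrix X i i := by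
  rw [← sum_hatMatrix_mul hX]
  exact Finset.sum_nonneg fun k _ => mul_self_nonneg _

theorem hatMatrix_sq_le (hX : IsUnit (Xᵀ * X).det) (i j : Fin n) :
    hatMatrix X i j ^ 2 ≤ hatMatrix X i i * hatMatrix X j j := by
  have := Finset.sum_mul_sq_le_sq_mul_sq Finset.univ (fun k => hatMatrix X k i)
    (fun k => hatMatrix X k j)
  simp only [sum_hatMatrix_mul hX, sq (hatMatrix X _ i), sq (hatMatrix X _ j)] at this
  simpa only [sq] using this

theorem hatMatrix_diag (X : Matrix (Fin n) (Fin d) ℝ) (i : Fin n) :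
    hatMatrix X i i = X i ⬝ᵥ ((Xᵀ * X)⁻¹ *ᵥ X i) := by
  rw [hatMatrix, Matrix.mul_assoc, Matrix.mul_apply]
  simp only [Matrix.mul_apply, Matrix.transpose_apply, dotProduct, Matrix.mulVec]

theorem lambdaMin_mul_hatMatrix_le (hpos : 0 < lambdaMin (Xᵀ * X)) {i : Fin n}
    (hi : X i ⬝ᵥ X i = 1) : lambdaMin (Xᵀ * X) * hatMatrix X i i ≤ 1 := by
  have := (dotProduct_inv_mulVec_le hpos (lambdaMin_mul_le (isHermitian_transpose_mul_self X))).2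
    (X i)
  rw [← hatMatrix_diag, hi, le_div_iff₀ hpos] at this
  linarith

theorem one_le_lambdaMax_mul_hatMatrix (hX : IsUnit (Xᵀ * X).det) {i : Fin n}
    (hi : X i ⬝ᵥ X i = 1) : 1 ≤ lambdaMax (Xᵀ * X) * hatMatrix X i i := by
  set z := (Xᵀ * X)⁻¹ *ᵥ X i with hz
  have hMz : (Xᵀ * X) *ᵥ z = X i := by
    rw [hz, Matrix.mulVec_mulVec, Matrix.mul_nonsing_inv _ hX, Matrix.one_mulVec]
  -- Cauchy-Schwarz for the form `⟨u, v⟩ = uᵀ XᵀX v`, applied to `xᵢ` and `(XᵀX)⁻¹ xᵢ`.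
  have h1 := dotProduct_sq_le (X *ᵥ X i) (X *ᵥ z)
  rw [← dotProduct_transpose_mul_mulVec, ← dotProduct_transpose_mul_mulVec,
    ← dotProduct_transpose_mul_mulVec, hMz, hi, dotProduct_comm z, hz, ← hatMatrix_diag] at h1
  have h2 := le_lambdaMax_mul (isHermitian_transpose_mul_self X) (X i)
  rw [hi, mul_one] at h2
  nlinarith [mul_le_mul_of_nonneg_right h2 (hatMatrix_diag_nonneg hX i)]

end HatMatrix

/-! ### One K-FAC step -/

section Step

variable {n d m : ℕ} {X : Matrix (Fin n) (Fin d) ℝ}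

/-- When `S` has full row rank, `(SᵀS)† Sᵀ` is the usual pseudoinverse `Sᵀ (SSᵀ)⁻¹` of `S`. -/
theorem pinv_mul_transpose {S : Matrix (Fin n) (Fin m) ℝ} (hS : IsUnit (S * Sᵀ).det) :
    pinv (Sᵀ * S) * Sᵀ = Sᵀ * (S * Sᵀ)⁻¹ := by
  set T := (S * Sᵀ)⁻¹ with hT
  have hTt : Tᵀ = T := by simp [hT, Matrix.transpose_nonsing_inv, Matrix.transpose_mul]
  have h1 : S * Sᵀ * T = 1 := Matrix.mul_nonsing_inv _ hS
  have h2 : T * (S * Sᵀ) = 1 := Matrix.nonsing_inv_mul _ hS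
  have hl : Sᵀ * S * (Sᵀ * T * T * S) = Sᵀ * T * S := by
    calc _ = Sᵀ * (S * Sᵀ * T) * T * S := by simp only [Matrix.mul_assoc]
      _ = _ := by rw [h1, Matrix.mul_one]
  have hr : Sᵀ * T * T * S * (Sᵀ * S) = Sᵀ * T * S := by
    calc _ = Sᵀ * T * (T * (S * Sᵀ)) * S := by simp only [Matrix.mul_assoc]
      _ = _ := by rw [h2, Matrix.mul_one]
  have hsymm : (Sᵀ * T * S)ᵀ = Sᵀ * T * S := by
    simp only [Matrix.transpose_mul, Matrix.transpose_transpose, hTt, Matrix.mul_assoc]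
  have hmp : IsMoorePenrose (Sᵀ * S) (Sᵀ * T * T * S) := by
    refine ⟨?_, ?_, ?_, ?_⟩
    · rw [hl]
      calc _ = Sᵀ * (T * (S * Sᵀ)) * S := by simp only [Matrix.mul_assoc]
        _ = _ := by rw [h2, Matrix.mul_one]
    · rw [hr]
      calc _ = Sᵀ * (T * (S * Sᵀ)) * T * T * S := by simp only [Matrix.mul_assoc]
        _ = _ := by rw [h2, Matrix.mul_one]
    · rw [hl, hsymm]
    · rw [hr, hsymm]
  rw [hmp.pinv_eq]
  calc _ = Sᵀ * T * (T * (S * Sᵀ)) := by simp only [Matrix.mul_assoc]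
    _ = _ := by rw [h2, Matrix.mul_one]

/-- The change of the pre-activations, divided by `-η`, that a K-FAC step causes when the residual
is `e`: row `r`, column `i` belongs to the unit `r` and the input `i`. -/
noncomputable def preactMove (X : Matrix (Fin n) (Fin d) ℝ) (S : Matrix (Fin n) (Fin m) ℝ)
    (e : Fin n → ℝ) : Matrix (Fin m) (Fin n) ℝ :=
  Sᵀ * (S * Sᵀ)⁻¹ * Matrix.diagonal e * hatMatrix X

theorem jacobian_transpose_mulVec (a : Fin m → ℝ) (w : Fin m → Fin d → ℝ) (e : Fin n → ℝ) :
    (jacobian X a w)ᵀ *ᵥ e = Matrix.vec ((preactDeriv X a w)ᵀ * Matrix.diagonal e * X) := by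
  funext p
  rw [Matrix.vec, Matrix.mul_apply]
  simp only [Matrix.mul_diagonal, Matrix.mulVec, dotProduct, Matrix.transpose_apply, jacobian,
    Matrix.of_apply, preactDeriv]
  exact Finset.sum_congr rfl fun i _ => by ring

theorem kfacStep_dotProduct (y : Fin n → ℝ) (a : Fin m → ℝ) (η : ℝ) (w : Fin m → Fin d → ℝ)
    (hS : IsUnit (preactDeriv X a w * (preactDeriv X a w)ᵀ).det) (r : Fin m) (i : Fin n) :
    kfacStep X y a η w r ⬝ᵥ X i
      = w r ⬝ᵥ X i - η * preactMove X (preactDeriv X a w) (output X a w - y) r i := by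
  set S := preactDeriv X a w
  set e := output X a w - y
  have h1 : ∀ j, kfacStep X y a η w r j
      = w r j - η * (Sᵀ * (S * Sᵀ)⁻¹ * Matrix.diagonal e * X * (Xᵀ * X)⁻¹) r j := by
    intro j
    have : kfacInv X a w *ᵥ ((jacobian X a w)ᵀ *ᵥ e)
        = Matrix.vec (Sᵀ * (S * Sᵀ)⁻¹ * Matrix.diagonal e * X * (Xᵀ * X)⁻¹) := by
      rw [jacobian_transpose_mulVec, kfacInv, Matrix.kronecker_mulVec_vec, ← pinv_mul_transpose hS,
        Matrix.transpose_nonsing_inv, Matrix.transpose_mul, Matrix.transpose_transpose]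
      simp only [Matrix.mul_assoc, S]
    rw [kfacStep, this]; rfl
  have h2 : preactMove X S e
      = Sᵀ * (S * Sᵀ)⁻¹ * Matrix.diagonal e * X * (Xᵀ * X)⁻¹ * Xᵀ := by
    simp only [preactMove, hatMatrix, Matrix.mul_assoc]
  rw [h2, Matrix.mul_apply]
  simp only [dotProduct, h1, Matrix.transpose_apply, sub_mul, Finset.sum_sub_distrib,
    Finset.mul_sum, mul_assoc]

/-- The squared residuals, weighted with the leverages `hatMatrix X j j` and summed. This quantity
controls both the progress and the length of a K-FAC step. -/
noncomputable def leverageEnergy (X : Matrix (Fin n) (Fin d) ℝ) (e : Fin n → ℝ) : ℝ :=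
  ∑ j, hatMatrix X j j * e j ^ 2

theorem leverageEnergy_nonneg (hX : IsUnit (Xᵀ * X).det) (e : Fin n → ℝ) :
    0 ≤ leverageEnergy X e :=
  Finset.sum_nonneg fun j _ => mul_nonneg (hatMatrix_diag_nonneg hX j) (sq_nonneg _)

theorem dotProduct_self_le_leverageEnergy (hX : IsUnit (Xᵀ * X).det)
    (hi : ∀ i, X i ⬝ᵥ X i = 1) (e : Fin n → ℝ) :
    e ⬝ᵥ e ≤ lambdaMax (Xᵀ * X) * leverageEnergy X e := by
  rw [dotProduct_self_eq_sum_sq, leverageEnergy, Finset.mul_sum]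
  refine Finset.sum_le_sum fun j _ => ?_
  nlinarith [mul_le_mul_of_nonneg_right (one_le_lambdaMax_mul_hatMatrix hX (hi j)) (sq_nonneg (e j))]

theorem lambdaMin_mul_leverageEnergy_le (hpos : 0 < lambdaMin (Xᵀ * X))
    (hi : ∀ i, X i ⬝ᵥ X i = 1) (e : Fin n → ℝ) :
    lambdaMin (Xᵀ * X) * leverageEnergy X e ≤ e ⬝ᵥ e := by
  rw [dotProduct_self_eq_sum_sq, leverageEnergy, Finset.mul_sum]
  refine Finset.sum_le_sum fun j _ => ?_
  nlinarith [mul_le_mul_of_nonneg_right (lambdaMin_mul_hatMatrix_le hpos (hi j)) (sq_nonneg (e j))]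

variable {S : Matrix (Fin n) (Fin m) ℝ} {σ : ℝ}

theorem isUnit_det_mul_transpose (hσ : 0 < σ)
    (hS : ∀ v, σ * (v ⬝ᵥ v) ≤ (Sᵀ *ᵥ v) ⬝ᵥ (Sᵀ *ᵥ v)) : IsUnit (S * Sᵀ).det :=
  (dotProduct_inv_mulVec_le hσ fun v => by
    simpa [← dotProduct_transpose_mul_mulVec] using hS v).1

theorem sum_preactMove_sq_le_sum (hσ : 0 < σ)
    (hS : ∀ v, σ * (v ⬝ᵥ v) ≤ (Sᵀ *ᵥ v) ⬝ᵥ (Sᵀ *ᵥ v)) (e : Fin n → ℝ) (i : Fin n) :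
    ∑ r, preactMove X S e r i ^ 2 ≤ (∑ j, hatMatrix X i j ^ 2 * e j ^ 2) / σ := by
  have key := dotProduct_inv_mulVec_le (A := S * Sᵀ) hσ fun v => by
    simpa [← dotProduct_transpose_mul_mulVec] using hS v
  set y : Fin n → ℝ := fun j => e j * hatMatrix X j i with hy
  have hcol : (fun r => preactMove X S e r i) = Sᵀ *ᵥ ((S * Sᵀ)⁻¹ *ᵥ y) := by
    funext r
    rw [preactMove, Matrix.mul_assoc, Matrix.mul_apply, Matrix.mulVec_mulVec]
    simp only [Matrix.mulVec, dotProduct, Matrix.diagonal_mul, hy]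
  calc ∑ r, preactMove X S e r i ^ 2
      = (Sᵀ *ᵥ ((S * Sᵀ)⁻¹ *ᵥ y)) ⬝ᵥ (Sᵀ *ᵥ ((S * Sᵀ)⁻¹ *ᵥ y)) := by
        rw [← hcol, dotProduct_self_eq_sum_sq]
    _ = y ⬝ᵥ ((S * Sᵀ)⁻¹ *ᵥ y) := by
        rw [← dotProduct_transpose_mul_mulVec, Matrix.transpose_transpose, Matrix.mulVec_mulVec,
          Matrix.mul_nonsing_inv _ key.1, Matrix.one_mulVec, dotProduct_comm]
    _ ≤ (y ⬝ᵥ y) / σ := key.2 y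
    _ = _ := by
        rw [dotProduct_self_eq_sum_sq]
        congr 1
        exact Finset.sum_congr rfl fun j _ => by rw [hy, hatMatrix_symm X i j]; ring

theorem sum_preactMove_sq_le (hX : IsUnit (Xᵀ * X).det) (hpos : 0 < lambdaMin (Xᵀ * X))
    (hi : ∀ i, X i ⬝ᵥ X i = 1) (hσ : 0 < σ)
    (hS : ∀ v, σ * (v ⬝ᵥ v) ≤ (Sᵀ *ᵥ v) ⬝ᵥ (Sᵀ *ᵥ v)) (e : Fin n → ℝ) (i : Fin n) :
    ∑ r, preactMove X S e r i ^ 2 ≤ leverageEnergy X e / (lambdaMin (Xᵀ * X) * σ) := by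
  refine (sum_preactMove_sq_le_sum hσ hS e i).trans ?_
  rw [← div_div]
  refine div_le_div_of_nonneg_right ?_ hσ.le
  rw [le_div_iff₀ hpos]
  calc (∑ j, hatMatrix X i j ^ 2 * e j ^ 2) * lambdaMin (Xᵀ * X)
      ≤ (∑ j, hatMatrix X i i * (hatMatrix X j j * e j ^ 2)) * lambdaMin (Xᵀ * X) := by
        refine mul_le_mul_of_nonneg_right (Finset.sum_le_sum fun j _ => ?_) hpos.le
        rw [← mul_assoc]
        exact mul_le_mul_of_nonneg_right (hatMatrix_sq_le hX i j) (sq_nonneg _)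
    _ = lambdaMin (Xᵀ * X) * hatMatrix X i i * leverageEnergy X e := by
        rw [← Finset.mul_sum, leverageEnergy]; ring
    _ ≤ leverageEnergy X e := mul_le_of_le_one_left (leverageEnergy_nonneg hX e)
        (lambdaMin_mul_hatMatrix_le hpos (hi i))

theorem sum_sum_preactMove_sq_le (hX : IsUnit (Xᵀ * X).det) (hσ : 0 < σ)
    (hS : ∀ v, σ * (v ⬝ᵥ v) ≤ (Sᵀ *ᵥ v) ⬝ᵥ (Sᵀ *ᵥ v)) (e : Fin n → ℝ) :
    ∑ i, ∑ r, preactMove X S e r i ^ 2 ≤ leverageEnergy X e / σ := by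
  refine (Finset.sum_le_sum fun i _ => sum_preactMove_sq_le_sum hσ hS e i).trans_eq ?_
  rw [← Finset.sum_div, Finset.sum_comm, leverageEnergy]
  congr 1
  refine Finset.sum_congr rfl fun j _ => ?_
  rw [← Finset.sum_mul, ← sum_hatMatrix_mul hX]
  simp only [sq]

/-- To first order, a K-FAC step multiplies the `i`-th residual by `1 - η * hatMatrix X i i`. -/
theorem sum_mul_preactMove (hS : IsUnit (S * Sᵀ).det) (e : Fin n → ℝ) (i : Fin n) :
    ∑ r, S i r * preactMove X S e r i = hatMatrix X i i * e i := by
  have : S * preactMove X S e = Matrix.diagonal e * hatMatrix X := by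
    calc _ = S * Sᵀ * (S * Sᵀ)⁻¹ * Matrix.diagonal e * hatMatrix X := by
          simp only [preactMove, Matrix.mul_assoc]
      _ = _ := by rw [Matrix.mul_nonsing_inv _ hS, Matrix.one_mul]
  rw [← Matrix.mul_apply, this, Matrix.diagonal_mul, mul_comm]

/-! ### Activation patterns -/

/-- The hidden units whose activation on the `i`-th input differs between the weights `w` and
`w'`. -/
noncomputable def flips (X : Matrix (Fin n) (Fin d) ℝ) (w w' : Fin m → Fin d → ℝ) (i : Fin n) :
    Finset (Fin m) :=
  {r | reluDeriv (w r ⬝ᵥ X i) ≠ reluDeriv (w' r ⬝ᵥ X i)}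

theorem mem_flips {w w' : Fin m → Fin d → ℝ} {i : Fin n} {r : Fin m} :
    r ∈ flips X w w' i ↔ reluDeriv (w r ⬝ᵥ X i) ≠ reluDeriv (w' r ⬝ᵥ X i) := by
  simp [flips]

/-- The fraction of activations, summed over the inputs, that differ between `w` and `w'`. -/
noncomputable def flipRate (X : Matrix (Fin n) (Fin d) ℝ) (w w' : Fin m → Fin d → ℝ) : ℝ :=
  (∑ i, ((flips X w w' i).card : ℝ)) / m

theorem abs_relu_sub_sub_le (z z' : ℝ) :
    |relu z' - relu z - reluDeriv z * (z' - z)|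
      ≤ if reluDeriv z ≠ reluDeriv z' then |z' - z| else 0 := by
  unfold relu reluDeriv
  rcases le_or_gt 0 z with h | h <;> rcases le_or_gt 0 z' with h' | h'
  · simp [h, h']
  · simp only [max_eq_left h, max_eq_right h'.le, if_pos h, if_neg h'.not_ge]
    rw [abs_of_neg (by linarith : z' - z < 0)]
    norm_num
    exact abs_le.2 ⟨by linarith, by linarith⟩
  · simp only [max_eq_right h.le, max_eq_left h', if_pos h', if_neg h.not_ge]
    rw [abs_of_pos (by linarith : 0 < z' - z)]
    norm_num
    exact abs_le.2 ⟨by linarith, by linarith⟩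
  · simp [h.le, h'.le, h.not_ge, h'.not_ge]

theorem abs_le_abs_sub_of_reluDeriv_ne {z z' : ℝ} (h : reluDeriv z ≠ reluDeriv z') :
    |z| ≤ |z' - z| := by
  unfold reluDeriv at h
  rcases le_or_gt 0 z with hz | hz <;> rcases le_or_gt 0 z' with hz' | hz'
  · simp [hz, hz'] at h
  · rw [abs_of_nonneg hz, abs_of_neg (by linarith)]; linarith
  · rw [abs_of_neg hz, abs_of_pos (by linarith)]; linarith
  · simp [hz.not_ge, hz'.not_ge] at h

theorem output_sub_output_sub (a : Fin m → ℝ) (w w' : Fin m → Fin d → ℝ) (i : Fin n) :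
    output X a w' i - output X a w i
        - ∑ r, preactDeriv X a w i r * (w' r ⬝ᵥ X i - w r ⬝ᵥ X i)
      = 1 / √(m : ℝ) * ∑ r, a r * (relu (w' r ⬝ᵥ X i) - relu (w r ⬝ᵥ X i)
          - reluDeriv (w r ⬝ᵥ X i) * (w' r ⬝ᵥ X i - w r ⬝ᵥ X i)) := by
  simp only [output, preactDeriv, Matrix.of_apply, Finset.mul_sum, ← Finset.sum_sub_distrib]
  exact Finset.sum_congr rfl fun r _ => by ring

/-- The error of the linearization of the `i`-th output: only units that flip contribute. -/
theorem sq_output_sub_output_sub_le {a : Fin m → ℝ} (ha : ∀ r, |a r| = 1)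
    (w w' : Fin m → Fin d → ℝ) (i : Fin n) :
    (output X a w' i - output X a w i
        - ∑ r, preactDeriv X a w i r * (w' r ⬝ᵥ X i - w r ⬝ᵥ X i)) ^ 2
      ≤ (flips X w w' i).card / m * ∑ r, (w' r ⬝ᵥ X i - w r ⬝ᵥ X i) ^ 2 := by
  rw [output_sub_output_sub]
  have h1 : |∑ r, a r * (relu (w' r ⬝ᵥ X i) - relu (w r ⬝ᵥ X i)
          - reluDeriv (w r ⬝ᵥ X i) * (w' r ⬝ᵥ X i - w r ⬝ᵥ X i))|
      ≤ ∑ r ∈ flips X w w' i, |w' r ⬝ᵥ X i - w r ⬝ᵥ X i| := by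
    rw [flips, Finset.sum_filter]
    refine (Finset.abs_sum_le_sum_abs _ _).trans (Finset.sum_le_sum fun r _ => ?_)
    rw [abs_mul, ha, one_mul]
    exact abs_relu_sub_sub_le _ _
  have h2 : (∑ r ∈ flips X w w' i, |w' r ⬝ᵥ X i - w r ⬝ᵥ X i|) ^ 2
      ≤ (flips X w w' i).card * ∑ r, (w' r ⬝ᵥ X i - w r ⬝ᵥ X i) ^ 2 := by
    refine sq_sum_le_card_mul_sum_sq.trans ?_
    refine mul_le_mul_of_nonneg_left ?_ (Nat.cast_nonneg _)
    simp only [sq_abs]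
    exact Finset.sum_le_sum_of_subset_of_nonneg (Finset.subset_univ _) fun _ _ _ => sq_nonneg _
  rw [mul_pow, div_pow, one_pow, Real.sq_sqrt (Nat.cast_nonneg m), div_mul_eq_mul_div,
    div_mul_eq_mul_div, one_mul]
  refine div_le_div_of_nonneg_right (le_trans ?_ h2) (Nat.cast_nonneg _)
  rw [← sq_abs]
  exact pow_le_pow_left₀ (abs_nonneg _) h1 2

end Step

section Convergence

variable {n d m : ℕ} {X : Matrix (Fin n) (Fin d) ℝ}

theorem flipRate_triangle (w₀ w w' : Fin m → Fin d → ℝ) :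
    flipRate X w w' ≤ flipRate X w₀ w + flipRate X w₀ w' := by
  unfold flipRate
  rw [← add_div, ← Finset.sum_add_distrib]
  refine div_le_div_of_nonneg_right (Finset.sum_le_sum fun i _ => ?_) (Nat.cast_nonneg _)
  have h : flips X w w' i ⊆ flips X w₀ w i ∪ flips X w₀ w' i := by
    intro r hr
    rw [Finset.mem_union]
    simp only [mem_flips] at hr ⊢
    by_contra! h
    exact hr (h.1.symm.trans h.2)
  exact_mod_cast (Finset.card_le_card h).trans (Finset.card_union_le _ _)

/-- The pre-activations of all hidden units on all inputs, as a vector with the Euclidean norm. -/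
noncomputable def preact (X : Matrix (Fin n) (Fin d) ℝ) (w : Fin m → Fin d → ℝ) :
    EuclideanSpace ℝ (Fin n × Fin m) :=
  WithLp.toLp 2 fun p => w p.2 ⬝ᵥ X p.1

theorem norm_preact_sub_sq (w w' : Fin m → Fin d → ℝ) :
    ‖preact X w' - preact X w‖ ^ 2 = ∑ i, ∑ r, (w' r ⬝ᵥ X i - w r ⬝ᵥ X i) ^ 2 := by
  rw [EuclideanSpace.real_norm_sq_eq, Fintype.sum_prod_type]
  simp [preact]

/-- A unit flips only if its initial pre-activation is small or its pre-activation has moved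
far. -/
theorem flipRate_le (w₀ w : Fin m → Fin d → ℝ) {R : ℝ} (hR : 0 < R) :
    flipRate X w₀ w ≤ (∑ i, ∑ r, if |w₀ r ⬝ᵥ X i| ≤ R then (1 : ℝ) else 0) / m
      + ‖preact X w - preact X w₀‖ ^ 2 / (m * R ^ 2) := by
  have h : ∑ i, ((flips X w₀ w i).card : ℝ)
      ≤ (∑ i, ∑ r, if |w₀ r ⬝ᵥ X i| ≤ R then (1 : ℝ) else 0)
        + ‖preact X w - preact X w₀‖ ^ 2 / R ^ 2 := by
    rw [norm_preact_sub_sq, Finset.sum_div, ← Finset.sum_add_distrib]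
    refine Finset.sum_le_sum fun i _ => ?_
    rw [flips, Finset.card_filter, Nat.cast_sum, Finset.sum_div, ← Finset.sum_add_distrib]
    refine Finset.sum_le_sum fun r _ => ?_
    have h0 : 0 ≤ (w r ⬝ᵥ X i - w₀ r ⬝ᵥ X i) ^ 2 / R ^ 2 := by positivity
    by_cases hf : reluDeriv (w₀ r ⬝ᵥ X i) ≠ reluDeriv (w r ⬝ᵥ X i)
    · rw [if_pos hf]
      by_cases hs : |w₀ r ⬝ᵥ X i| ≤ R
      · rw [if_pos hs]; push_cast; linarith
      · rw [if_neg hs, zero_add, Nat.cast_one, one_le_div (by positivity), ← sq_abs (_ - _)]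
        exact pow_le_pow_left₀ hR.le
          ((not_le.1 hs).le.trans (abs_le_abs_sub_of_reluDeriv_ne hf)) 2
    · rw [if_neg hf]
      split_ifs <;> push_cast <;> linarith
  rw [flipRate, mul_comm (m : ℝ), ← div_div, ← add_div]
  exact div_le_div_of_nonneg_right h (Nat.cast_nonneg _)

/-- Few flips change the Gram matrix `SSᵀ` of the activation patterns only a little, because
`flipRate` is the squared Frobenius distance of the two matrices `S`. -/
theorem preactDeriv_gram_lower_bound {a : Fin m → ℝ} (ha : ∀ r, |a r| = 1)
    {w₀ w : Fin m → Fin d → ℝ} {lam : ℝ} (hlam : 0 ≤ lam)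
    (h₀ : ∀ v, lam / 2 * (v ⬝ᵥ v)
      ≤ ((preactDeriv X a w₀)ᵀ *ᵥ v) ⬝ᵥ ((preactDeriv X a w₀)ᵀ *ᵥ v))
    (hF : flipRate X w₀ w ≤ lam / 128) (v : Fin n → ℝ) :
    lam / 4 * (v ⬝ᵥ v) ≤ ((preactDeriv X a w)ᵀ *ᵥ v) ⬝ᵥ ((preactDeriv X a w)ᵀ *ᵥ v) := by
  set S₀ := preactDeriv X a w₀ with hS₀
  set S := preactDeriv X a w with hS
  have hsq : ∑ i, ∑ r, (S₀ i r - S i r) ^ 2 = flipRate X w₀ w := by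
    rw [flipRate, Finset.sum_div]
    refine Finset.sum_congr rfl fun i _ => ?_
    rw [flips, Finset.card_filter, Nat.cast_sum, Finset.sum_div]
    refine Finset.sum_congr rfl fun r _ => ?_
    have har : a r ^ 2 = 1 := by rw [← sq_abs, ha, one_pow]
    have : (S₀ i r - S i r) ^ 2
        = (reluDeriv (w₀ r ⬝ᵥ X i) - reluDeriv (w r ⬝ᵥ X i)) ^ 2 / m := by
      simp only [hS₀, hS, preactDeriv, Matrix.of_apply]
      rw [← mul_sub, ← mul_sub, mul_pow, mul_pow, har, div_pow, one_pow,
        Real.sq_sqrt (Nat.cast_nonneg m)]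
      ring
    rw [this]
    congr 1
    unfold reluDeriv
    split_ifs <;> simp_all
  have hdiff : ∑ r, (((S₀)ᵀ *ᵥ v) r - (Sᵀ *ᵥ v) r) ^ 2 ≤ lam / 128 * (v ⬝ᵥ v) := by
    have : ∀ r, (((S₀)ᵀ *ᵥ v) r - (Sᵀ *ᵥ v) r) ^ 2 ≤ (∑ i, (S₀ i r - S i r) ^ 2) * (v ⬝ᵥ v) := by
      intro r
      rw [← Pi.sub_apply, ← Matrix.sub_mulVec, dotProduct_self_eq_sum_sq v]
      exact Finset.sum_mul_sq_le_sq_mul_sq Finset.univ (fun i => S₀ i r - S i r) v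
    calc _ ≤ ∑ r, (∑ i, (S₀ i r - S i r) ^ 2) * (v ⬝ᵥ v) := Finset.sum_le_sum fun r _ => this r
      _ = flipRate X w₀ w * (v ⬝ᵥ v) := by rw [← Finset.sum_mul, Finset.sum_comm, hsq]
      _ ≤ _ := mul_le_mul_of_nonneg_right hF (dotProduct_self_nonneg' v)
  have h1 := h₀ v
  -- Young's inequality; the weights are chosen so that `(1 / 2 - 3 / 128) / (3 / 2) ≥ 1 / 4`.
  have h2 : ∑ r, ((S₀)ᵀ *ᵥ v) r ^ 2
      ≤ 3 / 2 * ∑ r, (Sᵀ *ᵥ v) r ^ 2 + 3 * ∑ r, (((S₀)ᵀ *ᵥ v) r - (Sᵀ *ᵥ v) r) ^ 2 := by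
    rw [Finset.mul_sum, Finset.mul_sum, ← Finset.sum_add_distrib]
    refine Finset.sum_le_sum fun r _ => ?_
    nlinarith [sq_nonneg (2 * ((S₀)ᵀ *ᵥ v) r - 3 * (Sᵀ *ᵥ v) r)]
  rw [dotProduct_self_eq_sum_sq (_ *ᵥ _)] at h1 ⊢
  nlinarith [mul_nonneg hlam (dotProduct_self_nonneg' v)]

/-! ### Geometric decrease of the residual -/

theorem norm_preact_kfacStep_sub_sq_le (hX : IsUnit (Xᵀ * X).det) {y : Fin n → ℝ} {a : Fin m → ℝ}
    {η σ : ℝ} {w : Fin m → Fin d → ℝ} (hσ : 0 < σ)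
    (hS : ∀ v, σ * (v ⬝ᵥ v) ≤ ((preactDeriv X a w)ᵀ *ᵥ v) ⬝ᵥ ((preactDeriv X a w)ᵀ *ᵥ v)) :
    ‖preact X (kfacStep X y a η w) - preact X w‖ ^ 2
      ≤ η ^ 2 * leverageEnergy X (output X a w - y) / σ := by
  have := sum_sum_preactMove_sq_le hX hσ hS (output X a w - y)
  rw [norm_preact_sub_sq]
  simp only [kfacStep_dotProduct _ _ _ _ (isUnit_det_mul_transpose hσ hS), sub_sub_cancel_left,
    neg_sq, mul_pow, ← Finset.mul_sum]
  rw [mul_div_assoc]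
  exact mul_le_mul_of_nonneg_left this (sq_nonneg _)

/-- One K-FAC step decreases the squared residual by `η` times the leverage energy, provided that
few units flip during the step. -/
theorem residual_kfacStep_le [NeZero d] (hpos : 0 < lambdaMin (Xᵀ * X))
    (hX : IsUnit (Xᵀ * X).det) (hi : ∀ i, X i ⬝ᵥ X i = 1) {y : Fin n → ℝ} {a : Fin m → ℝ}
    (ha : ∀ r, |a r| = 1) {η σ : ℝ} {w : Fin m → Fin d → ℝ} (hσ : 0 < σ)
    (hS : ∀ v, σ * (v ⬝ᵥ v) ≤ ((preactDeriv X a w)ᵀ *ᵥ v) ⬝ᵥ ((preactDeriv X a w)ᵀ *ᵥ v))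
    (hη : 0 < η) (hη' : η ≤ 1 / 4 * lambdaMin (Xᵀ * X))
    (hF : flipRate X w (kfacStep X y a η w)
      ≤ lambdaMin (Xᵀ * X) * σ / (16 * lambdaMax (Xᵀ * X))) :
    (output X a (kfacStep X y a η w) - y) ⬝ᵥ (output X a (kfacStep X y a η w) - y)
      ≤ (output X a w - y) ⬝ᵥ (output X a w - y)
        - η * leverageEnergy X (output X a w - y) := by
  set w' := kfacStep X y a η w with hw'
  set e := output X a w - y with he
  set L := lambdaMax (Xᵀ * X) with hL
  set l := lambdaMin (Xᵀ * X) with hl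
  set q := leverageEnergy X e with hq
  have hq0 : 0 ≤ q := leverageEnergy_nonneg hX e
  have hlL : l ≤ L := lambdaMin_le_lambdaMax (isHermitian_transpose_mul_self X)
  have hLpos : 0 < L := hpos.trans_le hlL
  have hu := isUnit_det_mul_transpose hσ hS
  set g : Fin n → ℝ := fun i => (1 - η * hatMatrix X i i) * e i with hg
  set h : Fin n → ℝ := fun i => output X a w' i - output X a w i
        - ∑ r, preactDeriv X a w i r * (w' r ⬝ᵥ X i - w r ⬝ᵥ X i) with hh
  have hmove : ∀ r i, w' r ⬝ᵥ X i - w r ⬝ᵥ X i = -(η * preactMove X (preactDeriv X a w) e r i) := by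
    intro r i
    rw [hw', kfacStep_dotProduct _ _ _ _ hu, sub_sub_cancel_left]
  have hsplit : ∀ i, (output X a w' - y) i = g i + h i := by
    intro i
    have : ∑ r, preactDeriv X a w i r * (w' r ⬝ᵥ X i - w r ⬝ᵥ X i)
        = -(η * (hatMatrix X i i * e i)) := by
      rw [← sum_mul_preactMove hu e i, Finset.mul_sum, ← Finset.sum_neg_distrib]
      exact Finset.sum_congr rfl fun r _ => by rw [hmove]; ring
    simp only [hg, hh, this, Pi.sub_apply, he]
    ring
  have hG : ∑ i, g i ^ 2 ≤ e ⬝ᵥ e - 7 / 4 * (η * q) := by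
    rw [dotProduct_self_eq_sum_sq, hq, leverageEnergy, Finset.mul_sum, Finset.mul_sum,
      ← Finset.sum_sub_distrib]
    refine Finset.sum_le_sum fun i _ => ?_
    have h0 := hatMatrix_diag_nonneg hX i
    have h1 := lambdaMin_mul_hatMatrix_le hpos (hi i)
    have h2 : η * hatMatrix X i i ≤ 1 / 4 := by nlinarith
    have h3 : 0 ≤ η * hatMatrix X i i * e i ^ 2 := by positivity
    simp only [hg]
    nlinarith [mul_le_mul_of_nonneg_right h2 h3]
  have hH : ∑ i, h i ^ 2 ≤ η ^ 2 * q / (16 * L) := by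
    have h1 : ∀ i, h i ^ 2 ≤ (flips X w w' i).card / m * (η ^ 2 * (q / (l * σ))) := by
      intro i
      refine (sq_output_sub_output_sub_le ha w w' i).trans ?_
      refine mul_le_mul_of_nonneg_left ?_ (by positivity)
      simp only [hmove, neg_sq, mul_pow, ← Finset.mul_sum]
      exact mul_le_mul_of_nonneg_left (sum_preactMove_sq_le hX hpos hi hσ hS e i) (sq_nonneg _)
    calc ∑ i, h i ^ 2 ≤ ∑ i, (flips X w w' i).card / m * (η ^ 2 * (q / (l * σ))) :=
          Finset.sum_le_sum fun i _ => h1 i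
      _ = flipRate X w w' * (η ^ 2 * (q / (l * σ))) := by
          rw [← Finset.sum_mul, ← Finset.sum_div, flipRate]
      _ ≤ l * σ / (16 * L) * (η ^ 2 * (q / (l * σ))) :=
          mul_le_mul_of_nonneg_right hF (by positivity)
      _ = η ^ 2 * q / (16 * L) := by field_simp
  have hee : e ⬝ᵥ e ≤ L * q := dotProduct_self_le_leverageEnergy hX hi e
  -- Young's inequality with the weight `η / (4 L)`, which balances the two terms.
  set t := η / (4 * L) with ht
  have htpos : 0 < t := by positivity
  have hY : ∑ i, (g i + h i) ^ 2 ≤ (1 + t) * ∑ i, g i ^ 2 + (1 + 1 / t) * ∑ i, h i ^ 2 := by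
    rw [Finset.mul_sum, Finset.mul_sum, ← Finset.sum_add_distrib]
    refine Finset.sum_le_sum fun i _ => ?_
    have : 0 ≤ (t * g i - h i) ^ 2 / t := by positivity
    have h2 : (t * g i - h i) ^ 2 / t = t * g i ^ 2 - 2 * g i * h i + 1 / t * h i ^ 2 := by
      field_simp
      ring
    nlinarith
  have h1 : t * ∑ i, g i ^ 2 ≤ η * q / 4 := by
    calc t * ∑ i, g i ^ 2 ≤ t * (L * q) := by
          refine mul_le_mul_of_nonneg_left ?_ htpos.le
          nlinarith [mul_nonneg hη.le hq0]
      _ = η * q / 4 := by rw [ht]; field_simp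
  have h2 : 1 / t * ∑ i, h i ^ 2 ≤ η * q / 4 := by
    calc 1 / t * ∑ i, h i ^ 2 ≤ 1 / t * (η ^ 2 * q / (16 * L)) :=
          mul_le_mul_of_nonneg_left hH (by positivity)
      _ = η * q / 4 := by rw [ht]; field_simp; ring
  have h3 : ∑ i, h i ^ 2 ≤ η * q / 4 := by
    refine hH.trans ?_
    rw [div_le_iff₀ (by positivity)]
    nlinarith [mul_le_mul_of_nonneg_right (hη'.trans (by linarith : 1 / 4 * l ≤ L))
      (mul_nonneg hη.le hq0), mul_nonneg hLpos.le (mul_nonneg hη.le hq0)]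
  rw [dotProduct_self_eq_sum_sq]
  simp only [hsplit]
  nlinarith [mul_nonneg hη.le hq0]

/-- If the squared length `p` drops to `p' ≤ p - η q` and `p ≤ L q`, then the length drops by at
least `η √q / (2 √L)`; this is what makes the total path length of the iteration finite,
independently of the number of steps. -/
theorem step_le_mul_sub {p p' q η L : ℝ} (hp : 0 ≤ p) (hη : 0 < η)
    (hL : 0 < L) (hpq : p ^ 2 ≤ L * q) (hdec : p' ^ 2 ≤ p ^ 2 - η * q) :
    η * √q ≤ 2 * √L * (p - p') := by
  have hq : 0 ≤ q := by
    by_contra! h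
    nlinarith [sq_nonneg p]
  have hle : p' ≤ p := by
    refine abs_le_of_sq_le_sq' ?_ hp |>.2
    nlinarith [mul_nonneg hη.le hq]
  have hp1 : p ≤ √L * √q := by
    rw [← Real.sqrt_mul hL.le]; exact Real.le_sqrt_of_sq_le hpq
  rcases hq.eq_or_lt with h0 | h0
  · rw [← h0, Real.sqrt_zero, mul_zero]
    exact mul_nonneg (by positivity) (sub_nonneg.2 hle)
  have hsq : 0 < √q := Real.sqrt_pos.2 h0
  refine le_of_mul_le_mul_right ?_ hsq
  calc η * √q * √q = η * q := by rw [mul_assoc, Real.mul_self_sqrt hq]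
    _ ≤ (p - p') * (p + p') := by nlinarith
    _ ≤ (p - p') * (2 * (√L * √q)) := mul_le_mul_of_nonneg_left (by linarith) (sub_nonneg.2 hle)
    _ = _ := by ring

/-- Convergence of K-FAC from a good initialization `w₀`: the Gram matrix `SSᵀ` is bounded below at
`w₀`, and few units flip in the ball of pre-activations that contains the whole trajectory. -/
theorem kfacIter_converges [NeZero d] (hpos : 0 < lambdaMin (Xᵀ * X))
    (hX : IsUnit (Xᵀ * X).det) (hi : ∀ i, X i ⬝ᵥ X i = 1) {y : Fin n → ℝ} {a : Fin m → ℝ}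
    (ha : ∀ r, |a r| = 1) {η lam : ℝ} {w₀ : Fin m → Fin d → ℝ} (hlam : 0 < lam)
    (hS : ∀ v, lam / 2 * (v ⬝ᵥ v)
      ≤ ((preactDeriv X a w₀)ᵀ *ᵥ v) ⬝ᵥ ((preactDeriv X a w₀)ᵀ *ᵥ v))
    (hη : 0 < η) (hη' : η ≤ 1 / 4 * lambdaMin (Xᵀ * X))
    (hF : ∀ w, ‖preact X w - preact X w₀‖
        ≤ 4 * √(lambdaMax (Xᵀ * X)) / √lam * ‖WithLp.toLp 2 (output X a w₀ - y)‖ →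
      flipRate X w₀ w ≤ lam * lambdaMin (Xᵀ * X) / (128 * lambdaMax (Xᵀ * X))) (k : ℕ) :
    ‖WithLp.toLp 2 (output X a (kfacIter X y a η w₀ k) - y)‖ ^ 2
      ≤ (1 - η / lambdaMax (Xᵀ * X)) ^ k * ‖WithLp.toLp 2 (output X a w₀ - y)‖ ^ 2 := by
  set L := lambdaMax (Xᵀ * X) with hL
  set l := lambdaMin (Xᵀ * X) with hl
  have hlL : l ≤ L := lambdaMin_le_lambdaMax (isHermitian_transpose_mul_self X)
  have hLpos : 0 < L := hpos.trans_le hlL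
  have hsl : 0 < √lam := Real.sqrt_pos.2 hlam
  set K := 4 * √L / √lam with hK
  have hKpos : 0 < K := by positivity
  set E : (Fin m → Fin d → ℝ) → ℝ := fun w => ‖WithLp.toLp 2 (output X a w - y)‖ with hE
  have hE0 : ∀ w, 0 ≤ E w := fun w => norm_nonneg _
  have hsmall : lam * l / (128 * L) ≤ lam / 128 := by
    rw [div_le_div_iff₀ (by positivity) (by positivity)]
    nlinarith [mul_le_mul_of_nonneg_left hlL hlam.le]
  -- The potential `‖preact w - preact w₀‖ + K * E w` never exceeds its initial value.
  suffices key : ∀ k, ‖preact X (kfacIter X y a η w₀ k) - preact X w₀‖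
        ≤ K * (E w₀ - E (kfacIter X y a η w₀ k)) ∧
      E (kfacIter X y a η w₀ k) ^ 2 ≤ (1 - η / L) ^ k * E w₀ ^ 2 from (key k).2
  intro k
  induction k with
  | zero => simp [kfacIter]
  | succ k ih =>
    obtain ⟨ih1, ih2⟩ := ih
    set w := kfacIter X y a η w₀ k with hw
    have hw' : kfacIter X y a η w₀ (k + 1) = kfacStep X y a η w := rfl
    rw [hw']
    set w' := kfacStep X y a η w with hw'
    set q := leverageEnergy X (output X a w - y) with hq
    have hq0 : 0 ≤ q := leverageEnergy_nonneg hX _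
    have hEq : E w ^ 2 ≤ L * q := by
      rw [hE]; simp only [norm_toLp_sq]
      exact dotProduct_self_le_leverageEnergy hX hi _
    have hqE : l * q ≤ E w ^ 2 := by
      rw [hE]; simp only [norm_toLp_sq]
      exact lambdaMin_mul_leverageEnergy_le hpos hi _
    have hball : ‖preact X w - preact X w₀‖ ≤ K * E w₀ :=
      ih1.trans (mul_le_mul_of_nonneg_left (by linarith [hE0 w]) hKpos.le)
    have hFw := hF w hball
    have hSw := preactDeriv_gram_lower_bound ha hlam.le hS (hFw.trans hsmall)
    have hmove : ‖preact X w' - preact X w‖ ≤ 2 / √lam * (η * √q) := by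
      refine abs_le_of_sq_le_sq' ?_ (by positivity) |>.2
      refine (norm_preact_kfacStep_sub_sq_le hX (by positivity) hSw).trans_eq ?_
      rw [mul_pow, mul_pow, div_pow, Real.sq_sqrt hlam.le, Real.sq_sqrt hq0, ← hq]
      field_simp
      ring
    have htri : ‖preact X w' - preact X w₀‖
        ≤ ‖preact X w' - preact X w‖ + ‖preact X w - preact X w₀‖ :=
      norm_sub_le_norm_sub_add_norm_sub _ _ _
    have hball' : ‖preact X w' - preact X w₀‖ ≤ K * E w₀ := by
      -- A crude bound on the last step suffices here, since `η` is small.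
      have h1 : η * √q ≤ √L * E w := by
        refine abs_le_of_sq_le_sq' ?_ (by positivity) |>.2
        rw [mul_pow, mul_pow, Real.sq_sqrt hq0, Real.sq_sqrt hLpos.le]
        have hη1 : η * η ≤ L * l := mul_le_mul (by linarith) (by linarith) hη.le hLpos.le
        nlinarith [mul_le_mul_of_nonneg_right hη1 hq0, mul_le_mul_of_nonneg_left hqE hLpos.le]
      have h2 : 2 / √lam * (η * √q) ≤ K * E w := by
        calc 2 / √lam * (η * √q) ≤ 2 / √lam * (√L * E w) :=
              mul_le_mul_of_nonneg_left h1 (by positivity)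
          _ = K * E w / 2 := by rw [hK]; ring
          _ ≤ K * E w := by linarith [mul_nonneg hKpos.le (hE0 w)]
      linarith
    have hFw' := hF w' hball'
    have hdec : E w' ^ 2 ≤ E w ^ 2 - η * q := by
      rw [hE]; simp only [norm_toLp_sq]
      refine residual_kfacStep_le hpos hX hi ha (σ := lam / 4) (by positivity) hSw hη hη' ?_
      refine (flipRate_triangle w₀ w w').trans ((add_le_add hFw hFw').trans_eq ?_)
      rw [← hL, ← hl]
      field_simp
      norm_num
    have hstep := step_le_mul_sub (hE0 w) hη hLpos hEq hdec
    constructor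
    · have : 2 / √lam * (η * √q) ≤ K * (E w - E w') := by
        calc 2 / √lam * (η * √q) ≤ 2 / √lam * (2 * √L * (E w - E w')) :=
              mul_le_mul_of_nonneg_left hstep (by positivity)
          _ = _ := by rw [hK]; ring
      linarith
    · have h1 : E w' ^ 2 ≤ (1 - η / L) * E w ^ 2 := by
        have : η / L * E w ^ 2 ≤ η * q := by
          rw [div_mul_eq_mul_div, div_le_iff₀ hLpos]
          nlinarith
        linarith
      have h2 : 0 ≤ 1 - η / L := by
        rw [sub_nonneg, div_le_one hLpos]; linarith
      calc E w' ^ 2 ≤ (1 - η / L) * ((1 - η / L) ^ k * E w₀ ^ 2) :=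
            h1.trans (mul_le_mul_of_nonneg_left ih2 h2)
        _ = _ := by ring

end Convergence

/-! ### The limit Gram matrix is positive definite -/

section LimitGram

variable {n d : ℕ} {X : Matrix (Fin n) (Fin d) ℝ} {ν : ℝ}

theorem gaussianVec_eq :
    gaussianVec d ν = Measure.pi fun _ => gaussianReal 0 (Real.toNNReal (ν ^ 2)) := by
  rw [Real.toNNReal_of_nonneg (sq_nonneg ν)]; rfl

instance isProbabilityMeasure_gaussianVec : IsProbabilityMeasure (gaussianVec d ν) := by
  rw [gaussianVec_eq]; infer_instance

theorem isOpenPosMeasure_gaussianVec (hν : 0 < ν) : (gaussianVec d ν).IsOpenPosMeasure := by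
  have hv : Real.toNNReal (ν ^ 2) ≠ 0 := by simpa using hν.ne'
  have := (gaussianReal_absolutelyContinuous' 0 hv).isOpenPosMeasure
  rw [gaussianVec_eq]
  infer_instance

theorem reluDeriv_nonneg (z : ℝ) : 0 ≤ reluDeriv z := by unfold reluDeriv; split_ifs <;> norm_num

theorem reluDeriv_le_one (z : ℝ) : reluDeriv z ≤ 1 := by unfold reluDeriv; split_ifs <;> norm_num

@[fun_prop]
theorem measurable_reluDeriv : Measurable reluDeriv :=
  Measurable.ite measurableSet_Ici measurable_const measurable_const

@[fun_prop]
theorem continuous_dotProduct_const (x : Fin d → ℝ) : Continuous fun w : Fin d → ℝ => w ⬝ᵥ x := by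
  unfold dotProduct; fun_prop

@[fun_prop]
theorem measurable_dotProduct_const (x : Fin d → ℝ) : Measurable fun w : Fin d → ℝ => w ⬝ᵥ x :=
  (continuous_dotProduct_const x).measurable

theorem integrable_reluDeriv_mul (x x' : Fin d → ℝ) :
    Integrable (fun w => reluDeriv (w ⬝ᵥ x) * reluDeriv (w ⬝ᵥ x')) (gaussianVec d ν) := by
  refine Integrable.of_bound (C := 1) (by fun_prop) (ae_of_all _ fun w => ?_)
  rw [Real.norm_of_nonneg (mul_nonneg (reluDeriv_nonneg _) (reluDeriv_nonneg _))]
  exact mul_le_one₀ (reluDeriv_le_one _) (reluDeriv_nonneg _) (reluDeriv_le_one _)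

theorem isHermitian_limitGramS : (limitGramS X ν).IsHermitian := by
  ext i j
  simp [limitGramS, mul_comm]

theorem dotProduct_limitGramS (v : Fin n → ℝ) :
    v ⬝ᵥ (limitGramS X ν *ᵥ v)
      = ∫ w, (∑ i, v i * reluDeriv (w ⬝ᵥ X i)) ^ 2 ∂(gaussianVec d ν) := by
  have h : ∀ w : Fin d → ℝ, (∑ i, v i * reluDeriv (w ⬝ᵥ X i)) ^ 2
      = ∑ i, ∑ j, v i * v j * (reluDeriv (w ⬝ᵥ X i) * reluDeriv (w ⬝ᵥ X j)) := by
    intro w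
    rw [sq, Finset.sum_mul_sum]
    exact Finset.sum_congr rfl fun i _ => Finset.sum_congr rfl fun j _ => by ring
  simp only [h]
  refine Eq.symm ((integral_finsetSum _ fun i _ => integrable_finsetSum _ fun j _ =>
    (integrable_reluDeriv_mul _ _).const_mul _).trans ?_)
  simp only [dotProduct, Matrix.mulVec, limitGramS, Matrix.of_apply, Finset.mul_sum]
  refine Finset.sum_congr rfl fun i _ => ?_
  refine (integral_finsetSum _ fun j _ => (integrable_reluDeriv_mul _ _).const_mul _).trans ?_
  refine Finset.sum_congr rfl fun j _ => ?_
  rw [integral_const_mul]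
  simp only [dotProduct]
  ring

/-- A point of the hyperplane `xᵢ^⊥` that lies on none of the hyperplanes `xⱼ^⊥` with `j ≠ i`. -/
theorem exists_orthogonal_only_to (hi : ∀ i, X i ⬝ᵥ X i = 1)
    (hpar : ∀ i j, i ≠ j → ∀ t : ℝ, X i ≠ t • X j) (i : Fin n) :
    ∃ w : Fin d → ℝ, w ⬝ᵥ X i = 0 ∧ ∀ j, j ≠ i → w ⬝ᵥ X j ≠ 0 := by
  let f : Fin n → (Fin d → ℝ) →ₗ[ℝ] ℝ := fun j => 
    { toFun := fun w => w ⬝ᵥ X j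
      map_add' := fun u v => add_dotProduct u v _
      map_smul' := fun c u => smul_dotProduct c u _ }
  have hf : ∀ j w, f j w = w ⬝ᵥ X j := fun j w => rfl
  by_contra! hcon
  let p : {j // j ≠ i} → Subspace ℝ (LinearMap.ker (f i)) := fun j =>
    LinearMap.ker ((f j).comp (LinearMap.ker (f i)).subtype)
  have hcover : (⋃ j, (p j : Set (LinearMap.ker (f i)))) = Set.univ := by
    rw [Set.eq_univ_iff_forall]
    rintro ⟨w, hw⟩
    obtain ⟨j, hj, hwj⟩ := hcon w hw
    exact Set.mem_iUnion.2 ⟨⟨j, hj⟩, hwj⟩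
  obtain ⟨⟨j, hj⟩, htop⟩ := Subspace.exists_eq_top_of_iUnion_eq_univ hcover
  set w : Fin d → ℝ := X j - (X j ⬝ᵥ X i) • X i with hw
  have hwi : w ⬝ᵥ X i = 0 := by
    rw [hw, sub_dotProduct, smul_dotProduct, hi, smul_eq_mul, mul_one, sub_self]
  have hwj : w ⬝ᵥ X j = 0 := by
    have : (⟨w, hwi⟩ : LinearMap.ker (f i)) ∈ p ⟨j, hj⟩ := by rw [htop]; trivial
    exact this
  have hww : w ⬝ᵥ w = 0 := by
    conv_lhs => enter [2]; rw [hw]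
    rw [dotProduct_sub, dotProduct_smul, hwi, hwj, smul_zero, sub_zero]
  exact hpar j i hj _ (sub_eq_zero.1 (dotProduct_self_eq_zero.1 hww))

/-- The functions `w ↦ φ'(wᵀxᵢ)` are linearly independent in `L²` of the Gaussian measure: near a
point that lies on the hyperplane `xᵢ^⊥` alone, only the `i`-th function jumps. -/
theorem dotProduct_limitGramS_pos (hν : 0 < ν) (hi : ∀ i, X i ⬝ᵥ X i = 1)
    (hpar : ∀ i j, i ≠ j → ∀ t : ℝ, X i ≠ t • X j) {v : Fin n → ℝ} (hv : v ≠ 0) :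
    0 < v ⬝ᵥ (limitGramS X ν *ᵥ v) := by
  have := isOpenPosMeasure_gaussianVec (d := d) hν
  rw [dotProduct_limitGramS]
  set F : (Fin d → ℝ) → ℝ := fun w => ∑ i, v i * reluDeriv (w ⬝ᵥ X i) with hF
  refine lt_of_le_of_ne (integral_nonneg fun w => sq_nonneg _) fun h0 => ?_
  have hbound : ∀ w, |F w| ≤ ∑ i, |v i| := by
    intro w
    refine (Finset.abs_sum_le_sum_abs _ _).trans (Finset.sum_le_sum fun i _ => ?_)
    rw [abs_mul, abs_of_nonneg (reluDeriv_nonneg _)]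
    exact mul_le_of_le_one_right (abs_nonneg _) (reluDeriv_le_one _)
  have hint : Integrable (fun w => F w ^ 2) (gaussianVec d ν) := by
    refine Integrable.of_bound (C := (∑ i, |v i|) ^ 2) (by fun_prop) (ae_of_all _ fun w => ?_)
    rw [Real.norm_of_nonneg (sq_nonneg _), ← sq_abs]
    exact pow_le_pow_left₀ (abs_nonneg _) (hbound w) 2
  have hae : ∀ᵐ w ∂(gaussianVec d ν), F w = 0 := by
    have := (integral_eq_zero_iff_of_nonneg (fun w => sq_nonneg (F w)) hint).1 h0.symm
    filter_upwards [this] with w hw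
    exact pow_eq_zero_iff two_ne_zero |>.1 hw
  obtain ⟨i, hvi⟩ := Function.ne_iff.1 hv
  obtain ⟨w₀, hw₀, hw₀'⟩ := exists_orthogonal_only_to hi hpar i
  let O : Set (Fin d → ℝ) := {w | ∀ j, j ≠ i → 0 < (w₀ ⬝ᵥ X j) * (w ⬝ᵥ X j)}
  have hO : IsOpen O := by
    have : O = ⋂ j, {w | j ≠ i → 0 < (w₀ ⬝ᵥ X j) * (w ⬝ᵥ X j)} := by
      ext w; simp [O]
    rw [this]
    refine isOpen_iInter_of_finite fun j => ?_
    by_cases hj : j = i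
    · simp [hj]
    · simpa [hj] using isOpen_lt continuous_const
        ((continuous_dotProduct_const (X j)).const_mul (w₀ ⬝ᵥ X j))
  -- On either side of the hyperplane `xᵢ^⊥` there is a zero of `F` in `O`.
  have hex : ∀ s : ℝ, s ≠ 0 → ∃ w ∈ O, 0 < s * (w ⬝ᵥ X i) ∧ F w = 0 := by
    intro s hs
    let U : Set (Fin d → ℝ) := O ∩ {w | 0 < s * (w ⬝ᵥ X i)}
    have hU : IsOpen U := hO.inter (isOpen_lt continuous_const
      ((continuous_dotProduct_const (X i)).const_mul s))
    have hUne : U.Nonempty := by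
      have hcont : Filter.Tendsto (fun t : ℝ => w₀ + (t * s) • X i) (nhdsWithin 0 (Set.Ioi 0))
          (nhds w₀) := by
        have : Continuous fun t : ℝ => w₀ + (t * s) • X i := by fun_prop
        simpa using this.continuousWithinAt (s := Set.Ioi 0) (x := 0) |>.tendsto
      have hw₀O : w₀ ∈ O := fun j hj => mul_self_pos.2 (hw₀' j hj)
      obtain ⟨t, htO, ht⟩ := ((hcont.eventually (hO.mem_nhds hw₀O)).and
        self_mem_nhdsWithin).exists
      refine ⟨_, htO, ?_⟩
      simp only [Set.mem_ofPred_eq, add_dotProduct, smul_dotProduct, hw₀, hi, smul_eq_mul, mul_one,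
        zero_add]
      rw [mul_left_comm]
      exact mul_pos ht (mul_self_pos.2 hs)
    have hpos : (gaussianVec d ν) U ≠ 0 := hU.measure_ne_zero _ hUne
    by_contra! hcon
    refine hpos (measure_mono_null (fun w hw => ?_) hae)
    exact hcon w hw.1 hw.2
  obtain ⟨w₁, hO₁, hs₁, hz₁⟩ := hex 1 one_ne_zero
  obtain ⟨w₂, hO₂, hs₂, hz₂⟩ := hex (-1) (by norm_num)
  have hdiff : F w₁ - F w₂ = v i := by
    simp only [hF, ← Finset.sum_sub_distrib, ← mul_sub]
    rw [Finset.sum_eq_single i]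
    · have h1 : reluDeriv (w₁ ⬝ᵥ X i) = 1 := if_pos (by linarith)
      have h2 : reluDeriv (w₂ ⬝ᵥ X i) = 0 := if_neg (by linarith)
      rw [h1, h2]; ring
    · intro j _ hj
      have h1 := hO₁ j hj
      have h2 := hO₂ j hj
      have : reluDeriv (w₁ ⬝ᵥ X j) = reluDeriv (w₂ ⬝ᵥ X j) := by
        unfold reluDeriv
        rcases (hw₀' j hj).lt_or_gt with h | h
        · rw [if_neg, if_neg] <;> nlinarith
        · rw [if_pos, if_pos] <;> nlinarith
      rw [this]; ring
    · simp
  apply hvi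
  rw [← hdiff, hz₁, hz₂]; simp

variable [NeZero n]

theorem lambdaMin_limitGramS_pos (hν : 0 < ν) (hi : ∀ i, X i ⬝ᵥ X i = 1)
    (hpar : ∀ i j, i ≠ j → ∀ t : ℝ, X i ≠ t • X j) : 0 < lambdaMin (limitGramS X ν) :=
  lambdaMin_pos isHermitian_limitGramS fun _ hv => dotProduct_limitGramS_pos hν hi hpar hv

theorem lambdaMin_limitGramS_le_one : lambdaMin (limitGramS X ν) ≤ 1 := by
  have h := lambdaMin_mul_le (isHermitian_limitGramS (X := X) (ν := ν)) (Pi.single 0 1)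
  rw [dotProduct_limitGramS] at h
  simp only [dotProduct_single, Pi.single_eq_same, mul_one] at h
  refine h.trans ?_
  have : ∫ w, (∑ i, (Pi.single 0 1 : Fin n → ℝ) i * reluDeriv (w ⬝ᵥ X i)) ^ 2 ∂(gaussianVec d ν)
      ≤ ∫ _, (1 : ℝ) ∂(gaussianVec d ν) := by
    refine integral_mono_of_nonneg (ae_of_all _ fun w => sq_nonneg _) (integrable_const _)
      (ae_of_all _ fun w => ?_)
    simp only [Pi.single_apply, ite_mul, one_mul, zero_mul, Finset.sum_ite_eq', Finset.mem_univ,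
      if_true]
    exact pow_le_one₀ (reluDeriv_nonneg _) (reluDeriv_le_one _)
  simpa using this

end LimitGram

/-! ### The Gram matrix of the data -/

section DataGram

variable {n d : ℕ} {X : Matrix (Fin n) (Fin d) ℝ}

theorem lambdaMax_transpose_mul_self_le [NeZero d] (hi : ∀ i, X i ⬝ᵥ X i = 1) :
    lambdaMax (Xᵀ * X) ≤ n := by
  refine lambdaMax_le (isHermitian_transpose_mul_self X) fun v => ?_
  rw [dotProduct_transpose_mul_mulVec, dotProduct_self_eq_sum_sq]
  calc ∑ i, (X *ᵥ v) i ^ 2 ≤ ∑ _i : Fin n, v ⬝ᵥ v := by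
        refine Finset.sum_le_sum fun i _ => ?_
        have := dotProduct_sq_le (X i) v
        rwa [hi, one_mul] at this
    _ = n * (v ⬝ᵥ v) := by simp

theorem lambdaMin_transpose_mul_self_pos [NeZero d] (hr : X.rank = d) :
    0 < lambdaMin (Xᵀ * X) := by
  refine lambdaMin_pos (isHermitian_transpose_mul_self X) fun v hv => ?_
  rw [dotProduct_transpose_mul_mulVec]
  refine dotProduct_self_pos' fun h => hv ?_
  have hinj : Function.Injective X.mulVec := by
    rw [Matrix.mulVec_injective_iff, linearIndependent_iff_card_eq_finrank_span, Set.finrank,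
      ← Matrix.rank_eq_finrank_span_cols, hr, Fintype.card_fin]
  exact hinj (by rw [h, Matrix.mulVec_zero])

end DataGram

/-! ### One-dimensional marginals of the Gaussian vector -/

section Gaussian

variable {d : ℕ} {ν : ℝ} {x : Fin d → ℝ}

theorem map_dotProduct_gaussianVec (hx : x ⬝ᵥ x = 1) :
    (gaussianVec d ν).map (fun w => w ⬝ᵥ x) = gaussianReal 0 (Real.toNNReal (ν ^ 2)) := by
  rw [gaussianVec_eq]
  set v := Real.toNNReal (ν ^ 2) with hv
  have hmem : ∀ j, MemLp (fun z : ℝ => z * x j) 2 (gaussianReal 0 v) := fun j =>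
    (memLp_id_gaussianReal' 2 (by norm_num)).mul_const (x j)
  have hlaw : ∀ j, HasGaussianLaw (fun w : Fin d → ℝ => w j * x j)
      (Measure.pi fun _ => gaussianReal 0 v) := by
    intro j
    have h1 : HasLaw (fun w : Fin d → ℝ => w j) (gaussianReal 0 v)
        (Measure.pi fun _ => gaussianReal 0 v) :=
      ⟨(measurable_pi_apply j).aemeasurable,
        (measurePreserving_eval (fun _ : Fin d => gaussianReal 0 v) j).map_eq⟩
    exact (gaussianReal_mul_const h1 (x j)).hasGaussianLaw
  have hindep : iIndepFun (fun (j : Fin d) (w : Fin d → ℝ) => w j * x j)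
      (Measure.pi fun _ => gaussianReal 0 v) :=
    iIndepFun_pi (X := fun j (z : ℝ) => z * x j) fun j => by fun_prop
  have hmean : (∫ w : Fin d → ℝ, ∑ j, w j * x j ∂(Measure.pi fun _ => gaussianReal 0 v)) = 0 := by
    rw [integral_finsetSum _ fun j _ => (hlaw j).integrable]
    refine Finset.sum_eq_zero fun j _ => ?_
    rw [integral_mul_const, integral_comp_eval (μ := fun _ : Fin d => gaussianReal 0 v)
      (f := fun z => z) (by fun_prop), integral_id_gaussianReal, zero_mul]
  have hvar : Var[fun w : Fin d → ℝ => ∑ j, w j * x j; Measure.pi fun _ => gaussianReal 0 v]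
      = v := by
    have h1 : (fun w : Fin d → ℝ => ∑ j, w j * x j)
        = ∑ j, fun w : Fin d → ℝ => (fun z : ℝ => z * x j) (w j) := by
      ext w; simp
    rw [h1, variance_sum_pi hmem]
    have h2 : ∀ j, Var[fun z : ℝ => z * x j; gaussianReal 0 v] = v * x j ^ 2 := by
      intro j
      rw [variance_mul_const, variance_fun_id_gaussianReal]
    simp only [h2]
    rw [← Finset.mul_sum, ← dotProduct_self_eq_sum_sq, hx, mul_one]
  have := (hindep.hasGaussianLaw_fun_sum hlaw).map_eq_gaussianReal
  rw [hmean, hvar, Real.toNNReal_coe] at this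
  exact this

theorem memLp_dotProduct_gaussianVec (hx : x ⬝ᵥ x = 1) :
    MemLp (fun w => w ⬝ᵥ x) 2 (gaussianVec d ν) := by
  have h : MemLp id 2 ((gaussianVec d ν).map (fun w => w ⬝ᵥ x)) := by
    rw [map_dotProduct_gaussianVec hx]
    exact memLp_id_gaussianReal' 2 (by norm_num)
  exact h.comp_of_map (by fun_prop)

theorem integral_dotProduct_sq_gaussianVec (hx : x ⬝ᵥ x = 1) :
    ∫ w, (w ⬝ᵥ x) ^ 2 ∂(gaussianVec d ν) = ν ^ 2 := by
  have h : ∫ z, z ^ 2 ∂((gaussianVec d ν).map (fun w => w ⬝ᵥ x)) = ν ^ 2 := by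
    rw [map_dotProduct_gaussianVec hx]
    have h1 := variance_fun_id_gaussianReal (μ := 0) (v := Real.toNNReal (ν ^ 2))
    rw [variance_of_integral_eq_zero (by fun_prop) integral_id_gaussianReal] at h1
    rw [h1, Real.coe_toNNReal _ (sq_nonneg ν)]
  rw [← h, integral_map (by fun_prop) (by fun_prop)]

/-- Anti-concentration: the Gaussian density is bounded by `1 / (2ν)`. -/
theorem measureReal_abs_dotProduct_le (hν : 0 < ν) (hx : x ⬝ᵥ x = 1) {R : ℝ} (hR : 0 ≤ R) :
    (gaussianVec d ν).real {w | |w ⬝ᵥ x| ≤ R} ≤ R / ν := by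
  have hv : Real.toNNReal (ν ^ 2) ≠ 0 := by simpa using hν.ne'
  have hset : {w : Fin d → ℝ | |w ⬝ᵥ x| ≤ R} = (fun w => w ⬝ᵥ x) ⁻¹' Set.Icc (-R) R := by
    ext w; simp [abs_le]
  rw [hset, measureReal_def, ← Measure.map_apply (by fun_prop) measurableSet_Icc,
    map_dotProduct_gaussianVec hx, gaussianReal_apply_eq_integral _ hv, ENNReal.toReal_ofReal
      (integral_nonneg fun _ => gaussianPDFReal_nonneg _ _ _)]
  have hpdf : ∀ z, gaussianPDFReal 0 (Real.toNNReal (ν ^ 2)) z ≤ 1 / (2 * ν) := by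
    intro z
    rw [gaussianPDFReal, Real.coe_toNNReal _ (sq_nonneg ν)]
    have h1 : Real.exp (-(z - 0) ^ 2 / (2 * ν ^ 2)) ≤ 1 := by
      rw [Real.exp_le_one_iff]
      exact div_nonpos_of_nonpos_of_nonneg (by nlinarith [sq_nonneg (z - 0)]) (by positivity)
    have h2 : 2 * ν ≤ √(2 * Real.pi * ν ^ 2) := by
      refine Real.le_sqrt_of_sq_le ?_
      nlinarith [Real.pi_gt_three, sq_nonneg ν]
    calc _ ≤ (√(2 * Real.pi * ν ^ 2))⁻¹ * 1 := mul_le_mul_of_nonneg_left h1 (by positivity)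
      _ ≤ 1 / (2 * ν) := by
        rw [mul_one, one_div]
        exact inv_anti₀ (by positivity) h2
  calc _ ≤ ∫ _ in Set.Icc (-R) R, 1 / (2 * ν) := by
        refine setIntegral_mono_on (integrable_gaussianPDFReal _ _).integrableOn
          (integrableOn_const (by simp)) measurableSet_Icc fun z _ => hpdf z
    _ = R / ν := by
        rw [setIntegral_const, measureReal_def, Real.volume_Icc, ENNReal.toReal_ofReal (by linarith),
          smul_eq_mul]
        field_simp
        ring

end Gaussian

/-! ### Moments of the initialization -/

section Initialization

theorem integral_comp_measurePreserving {α β : Type*} [MeasurableSpace α] [MeasurableSpace β]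
    {μ : Measure α} {μ' : Measure β} {g : α → β} (hg : MeasurePreserving g μ μ') {f : β → ℝ}
    (hf : AEStronglyMeasurable f μ') : ∫ x, f (g x) ∂μ = ∫ z, f z ∂μ' := by
  rw [← hg.map_eq, integral_map hg.aemeasurable (by rwa [hg.map_eq])]

instance isProbabilityMeasure_sign : IsProbabilityMeasure (uniformOn ({-1, 1} : Set ℝ)) :=
  isProbabilityMeasure_uniformOn (by simp) (by simp)

theorem ae_abs_eq_one_sign : ∀ᵐ x ∂(uniformOn ({-1, 1} : Set ℝ)), |x| = 1 := by
  have h : ∀ᵐ x ∂(uniformOn ({-1, 1} : Set ℝ)), x ∈ ({-1, 1} : Set ℝ) :=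
    ae_cond_mem (Set.Finite.measurableSet (by simp))
  filter_upwards [h] with x hx
  rcases hx with rfl | rfl <;> simp

theorem integral_sign : ∫ x, x ∂(uniformOn ({-1, 1} : Set ℝ)) = 0 := by
  have hc : ∀ x : ℝ, Measure.count {x} < ⊤ := fun x => by
    rw [Measure.count_singleton]; exact ENNReal.one_lt_top
  rw [uniformOn, ProbabilityTheory.cond, integral_smul_measure, Set.insert_eq,
    setIntegral_union (by norm_num) (measurableSet_singleton _) (integrableOn_singleton (hx := hc _))
      (integrableOn_singleton (hx := hc _)), integral_singleton, integral_singleton]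
  simp [measureReal_def]

variable {n d m : ℕ} {ν : ℝ}

theorem ae_abs_eq_one_signs :
    ∀ᵐ a ∂(Measure.pi fun _ : Fin m => uniformOn ({-1, 1} : Set ℝ)), ∀ r, |a r| = 1 :=
  ae_all_iff.2 fun r => (measurePreserving_eval (fun _ : Fin m => uniformOn ({-1, 1} : Set ℝ))
    r).quasiMeasurePreserving.ae ae_abs_eq_one_sign

instance isProbabilityMeasure_initLaw : IsProbabilityMeasure (initLaw m d ν) := by
  unfold initLaw; infer_instance

theorem ae_abs_eq_one_initLaw : ∀ᵐ ω ∂(initLaw m d ν), ∀ r, |ω.2 r| = 1 := by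
  exact Measure.quasiMeasurePreserving_snd.ae ae_abs_eq_one_signs

theorem measurePreserving_weights :
    MeasurePreserving (Prod.fst : (Fin m → Fin d → ℝ) × (Fin m → ℝ) → _) (initLaw m d ν)
      (Measure.pi fun _ => gaussianVec d ν) := by
  unfold initLaw; exact measurePreserving_fst

theorem measurePreserving_weight (r : Fin m) :
    MeasurePreserving (fun w : Fin m → Fin d → ℝ => w r) (Measure.pi fun _ => gaussianVec d ν)
      (gaussianVec d ν) :=
  measurePreserving_eval (fun _ : Fin m => gaussianVec d ν) r

theorem measurePreserving_initLaw_weight (r : Fin m) :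
    MeasurePreserving (fun ω : (Fin m → Fin d → ℝ) × (Fin m → ℝ) => ω.1 r) (initLaw m d ν)
      (gaussianVec d ν) :=
  (measurePreserving_weight r).comp measurePreserving_weights

variable {X : Matrix (Fin n) (Fin d) ℝ}

/-- The number of pairs of an input and a hidden unit whose pre-activation is at most `R` in
absolute value. -/
noncomputable def nearCount (X : Matrix (Fin n) (Fin d) ℝ) (R : ℝ) (w : Fin m → Fin d → ℝ) : ℝ :=
  ∑ i, ∑ r, if |w r ⬝ᵥ X i| ≤ R then (1 : ℝ) else 0

theorem integral_nearCount_le (hν : 0 < ν) (hi : ∀ i, X i ⬝ᵥ X i = 1) {R : ℝ} (hR : 0 ≤ R) :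
    Integrable (fun ω : (Fin m → Fin d → ℝ) × (Fin m → ℝ) => nearCount X R ω.1) (initLaw m d ν) ∧
      ∫ ω, nearCount X R ω.1 ∂(initLaw m d ν) ≤ n * m * (R / ν) := by
  have hmeas : ∀ i, MeasurableSet {w : Fin d → ℝ | |w ⬝ᵥ X i| ≤ R} := fun i =>
    measurableSet_le (by fun_prop) measurable_const
  have hind : ∀ i, (fun w : Fin d → ℝ => if |w ⬝ᵥ X i| ≤ R then (1 : ℝ) else 0)
      = {w : Fin d → ℝ | |w ⬝ᵥ X i| ≤ R}.indicator 1 := by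
    intro i; ext w; simp [Set.indicator]
  have hint₀ : ∀ i, Integrable (fun w : Fin d → ℝ => if |w ⬝ᵥ X i| ≤ R then (1 : ℝ) else 0)
      (gaussianVec d ν) := by
    intro i
    rw [hind]
    exact (integrable_const 1).indicator (hmeas i)
  have hint : ∀ i (r : Fin m), Integrable (fun ω : (Fin m → Fin d → ℝ) × (Fin m → ℝ) =>
      if |ω.1 r ⬝ᵥ X i| ≤ R then (1 : ℝ) else 0) (initLaw m d ν) := fun i r =>
    (measurePreserving_initLaw_weight r).integrable_comp_of_integrable (hint₀ i)
  refine ⟨integrable_finsetSum _ fun i _ => integrable_finsetSum _ fun r _ => hint i r, ?_⟩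
  unfold nearCount
  refine (integral_finsetSum _ fun i _ => integrable_finsetSum _ fun r _ => hint i r).trans_le ?_
  calc _ ≤ ∑ _i : Fin n, ∑ _r : Fin m, R / ν := by
        refine Finset.sum_le_sum fun i _ =>
          (integral_finsetSum _ fun r _ => hint i r).trans_le (Finset.sum_le_sum fun r _ => ?_)
        refine le_trans (le_of_eq ?_) (measureReal_abs_dotProduct_le hν (hi i) hR)
        rw [← integral_indicator_one (hmeas i), ← hind]
        exact integral_comp_measurePreserving (measurePreserving_initLaw_weight r)
          (hint₀ i).aestronglyMeasurable
    _ = n * m * (R / ν) := by simp [mul_assoc]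

theorem integrable_sign_mul (r s : Fin m) :
    Integrable (fun a : Fin m → ℝ => a r * a s)
      (Measure.pi fun _ : Fin m => uniformOn ({-1, 1} : Set ℝ)) := by
  refine Integrable.of_bound (C := 1) (by fun_prop) ?_
  filter_upwards [ae_abs_eq_one_signs] with a ha
  rw [Real.norm_eq_abs, abs_mul, ha, ha, mul_one]

theorem integral_sign_mul (r s : Fin m) :
    ∫ a : Fin m → ℝ, a r * a s ∂(Measure.pi fun _ : Fin m => uniformOn ({-1, 1} : Set ℝ))
      = if r = s then 1 else 0 := by
  split_ifs with h
  · subst h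
    have h1 : ∀ᵐ a ∂(Measure.pi fun _ : Fin m => uniformOn ({-1, 1} : Set ℝ)), a r * a r = 1 := by
      filter_upwards [ae_abs_eq_one_signs] with a ha
      rw [← abs_mul_abs_self, ha, one_mul]
    rw [integral_congr_ae h1]
    simp
  · have hind : IndepFun (fun a : Fin m → ℝ => a r) (fun a : Fin m → ℝ => a s)
        (Measure.pi fun _ : Fin m => uniformOn ({-1, 1} : Set ℝ)) :=
      (iIndepFun_pi (μ := fun _ : Fin m => uniformOn ({-1, 1} : Set ℝ))
        (X := fun _ z => z) fun _ => by fun_prop).indepFun h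
    rw [hind.integral_fun_mul_eq_mul_integral (measurable_pi_apply r).aestronglyMeasurable
      (measurable_pi_apply s).aestronglyMeasurable,
      integral_comp_eval (μ := fun _ : Fin m => uniformOn ({-1, 1} : Set ℝ))
      (f := fun z => z) (by fun_prop), integral_sign, zero_mul]

@[fun_prop]
theorem measurable_relu : Measurable relu := measurable_id.max measurable_const

theorem sq_relu_le (z : ℝ) : relu z ^ 2 ≤ z ^ 2 := by
  unfold relu
  rcases le_total z 0 with h | h
  · rw [max_eq_right h]; nlinarith [sq_nonneg z]
  · rw [max_eq_left h]

/-- The random signs make the summands of an output orthogonal, so that its second moment is that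
of a single hidden unit. -/
theorem integral_output_sq_le (hi : ∀ i, X i ⬝ᵥ X i = 1) (i : Fin n) :
    Integrable (fun ω : (Fin m → Fin d → ℝ) × (Fin m → ℝ) => output X ω.2 ω.1 i ^ 2)
        (initLaw m d ν) ∧
      ∫ ω, output X ω.2 ω.1 i ^ 2 ∂(initLaw m d ν) ≤ ν ^ 2 := by
  have hrelu₀ : MemLp (fun w : Fin d → ℝ => relu (w ⬝ᵥ X i)) 2 (gaussianVec d ν) := by
    refine (memLp_dotProduct_gaussianVec (hi i)).mono
      (measurable_relu.comp (measurable_dotProduct_const _)).aestronglyMeasurable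
      (ae_of_all _ fun w => ?_)
    rw [Real.norm_eq_abs, Real.norm_eq_abs]
    exact sq_le_sq.1 (sq_relu_le _)
  have hrelu : ∀ r : Fin m, MemLp (fun w : Fin m → Fin d → ℝ => relu (w r ⬝ᵥ X i)) 2
      (Measure.pi fun _ => gaussianVec d ν) := fun r =>
    hrelu₀.comp_measurePreserving (measurePreserving_weight r)
  have hexp : ∀ ω : (Fin m → Fin d → ℝ) × (Fin m → ℝ), output X ω.2 ω.1 i ^ 2
      = 1 / m * ∑ r, ∑ s, (relu (ω.1 r ⬝ᵥ X i) * relu (ω.1 s ⬝ᵥ X i)) * (ω.2 r * ω.2 s) := by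
    intro ω
    rw [output, mul_pow, div_pow, one_pow, Real.sq_sqrt (Nat.cast_nonneg m), sq (∑ r, _),
      Finset.sum_mul_sum]
    congr 1
    exact Finset.sum_congr rfl fun r _ => Finset.sum_congr rfl fun s _ => by ring
  have hint : ∀ r s, Integrable (fun ω : (Fin m → Fin d → ℝ) × (Fin m → ℝ) =>
      (relu (ω.1 r ⬝ᵥ X i) * relu (ω.1 s ⬝ᵥ X i)) * (ω.2 r * ω.2 s)) (initLaw m d ν) := by
    intro r s
    unfold initLaw
    exact ((hrelu r).integrable_mul (hrelu s)).mul_prod (integrable_sign_mul r s)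
  have hint' : Integrable (fun ω : (Fin m → Fin d → ℝ) × (Fin m → ℝ) =>
      ∑ r, ∑ s, (relu (ω.1 r ⬝ᵥ X i) * relu (ω.1 s ⬝ᵥ X i)) * (ω.2 r * ω.2 s))
      (initLaw m d ν) :=
    integrable_finsetSum _ fun r _ => integrable_finsetSum _ fun s _ => hint r s
  simp only [hexp]
  refine ⟨hint'.const_mul _, ?_⟩
  rw [integral_const_mul]
  have hval : ∀ r s, ∫ ω, (relu (ω.1 r ⬝ᵥ X i) * relu (ω.1 s ⬝ᵥ X i)) * (ω.2 r * ω.2 s)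
      ∂(initLaw m d ν) ≤ if r = s then ν ^ 2 else 0 := by
    intro r s
    unfold initLaw
    rw [integral_prod_mul (fun w : Fin m → Fin d → ℝ => relu (w r ⬝ᵥ X i) * relu (w s ⬝ᵥ X i))
      (fun a : Fin m → ℝ => a r * a s), integral_sign_mul]
    split_ifs with h
    · subst h
      rw [mul_one, ← integral_dotProduct_sq_gaussianVec (ν := ν) (hi i),
        integral_comp_eval (μ := fun _ : Fin m => gaussianVec d ν) (i := r)
          (f := fun w => relu (w ⬝ᵥ X i) * relu (w ⬝ᵥ X i)) (by fun_prop)]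
      refine integral_mono (hrelu₀.integrable_mul hrelu₀)
        (memLp_dotProduct_gaussianVec (hi i)).integrable_sq fun w => ?_
      simpa [sq] using sq_relu_le (w ⬝ᵥ X i)
    · simp
  have hsum : ∫ ω, ∑ r, ∑ s, (relu (ω.1 r ⬝ᵥ X i) * relu (ω.1 s ⬝ᵥ X i)) * (ω.2 r * ω.2 s)
      ∂(initLaw m d ν) ≤ m * ν ^ 2 := by
    refine (integral_finsetSum _ fun r _ => integrable_finsetSum _ fun s _ => hint r s).trans_le ?_
    calc _ ≤ ∑ r : Fin m, ∑ s : Fin m, if r = s then ν ^ 2 else 0 :=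
          Finset.sum_le_sum fun r _ => (integral_finsetSum _ fun s _ => hint r s).trans_le
            (Finset.sum_le_sum fun s _ => hval r s)
      _ = m * ν ^ 2 := by simp
  rcases Nat.eq_zero_or_pos m with hm | hm
  · rw [hm, Nat.cast_zero, div_zero, zero_mul]; positivity
  · have hm' : (0 : ℝ) < m := Nat.cast_pos.2 hm
    rw [one_div, inv_mul_le_iff₀ hm']
    exact hsum

theorem integral_residual_le (hi : ∀ i, X i ⬝ᵥ X i = 1) {y : Fin n → ℝ} {B : ℝ}
    (hy : ∀ i, |y i| ≤ B) :
    Integrable (fun ω : (Fin m → Fin d → ℝ) × (Fin m → ℝ) =>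
        2 * (∑ i, output X ω.2 ω.1 i ^ 2) + 2 * (∑ i, y i ^ 2)) (initLaw m d ν) ∧
      ∫ ω, (2 * (∑ i, output X ω.2 ω.1 i ^ 2) + 2 * (∑ i, y i ^ 2)) ∂(initLaw m d ν)
        ≤ 2 * n * (ν ^ 2 + B ^ 2) := by
  have hint : Integrable (fun ω : (Fin m → Fin d → ℝ) × (Fin m → ℝ) =>
      ∑ i, output X ω.2 ω.1 i ^ 2) (initLaw m d ν) :=
    integrable_finsetSum _ fun i _ => (integral_output_sq_le hi i).1
  refine ⟨(hint.const_mul 2).add (integrable_const _), ?_⟩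
  rw [integral_add (hint.const_mul 2) (integrable_const _), integral_const_mul,
    integral_finsetSum _ fun i _ => (integral_output_sq_le hi i).1]
  have h1 : ∑ i, ∫ ω, output X ω.2 ω.1 i ^ 2 ∂(initLaw m d ν) ≤ n * ν ^ 2 :=
    (Finset.sum_le_sum fun i _ => (integral_output_sq_le hi i).2).trans_eq (by simp)
  have h2 : ∑ i, y i ^ 2 ≤ n * B ^ 2 := by
    refine (Finset.sum_le_sum fun i _ => ?_).trans_eq (b := ∑ _i : Fin n, B ^ 2) (by simp)
    rw [← sq_abs]
    exact pow_le_pow_left₀ (abs_nonneg _) (hy i) 2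
  simp only [integral_const, probReal_univ, one_smul]
  linarith

/-- The Gram matrix of the activation patterns of `m` hidden units, the empirical version of
`limitGramS`. -/
noncomputable def empGram (X : Matrix (Fin n) (Fin d) ℝ) (w : Fin m → Fin d → ℝ) :
    Matrix (Fin n) (Fin n) ℝ :=
  Matrix.of fun i j => 1 / (m : ℝ) * ∑ r, reluDeriv (w r ⬝ᵥ X i) * reluDeriv (w r ⬝ᵥ X j)

theorem preactDeriv_mul_transpose {a : Fin m → ℝ} (ha : ∀ r, |a r| = 1)
    (w : Fin m → Fin d → ℝ) :
    preactDeriv X a w * (preactDeriv X a w)ᵀ = empGram X w := by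
  ext i j
  rw [Matrix.mul_apply, empGram, Matrix.of_apply, Finset.mul_sum]
  refine Finset.sum_congr rfl fun r _ => ?_
  have har : a r * a r = 1 := by rw [← abs_mul_abs_self, ha, one_mul]
  have hm : 1 / √(m : ℝ) * (1 / √(m : ℝ)) = 1 / m := by
    rw [div_mul_div_comm, one_mul, Real.mul_self_sqrt (Nat.cast_nonneg m)]
  simp only [preactDeriv, Matrix.of_apply, Matrix.transpose_apply]
  linear_combination (reluDeriv (w r ⬝ᵥ X i) * reluDeriv (w r ⬝ᵥ X j)) *
    (1 / √(m : ℝ) * (1 / √(m : ℝ)) * har + hm)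

theorem integral_empGram_sub_sq_le (hm : 0 < m) (i j : Fin n) :
    Integrable (fun ω : (Fin m → Fin d → ℝ) × (Fin m → ℝ) =>
        (empGram X ω.1 i j - limitGramS X ν i j) ^ 2) (initLaw m d ν) ∧
      ∫ ω, (empGram X ω.1 i j - limitGramS X ν i j) ^ 2 ∂(initLaw m d ν) ≤ 1 / m := by
  have hm' : (0 : ℝ) < m := Nat.cast_pos.2 hm
  set f : (Fin d → ℝ) → ℝ := fun w => reluDeriv (w ⬝ᵥ X i) * reluDeriv (w ⬝ᵥ X j) with hf
  have hf0 : ∀ w, 0 ≤ f w := fun w => mul_nonneg (reluDeriv_nonneg _) (reluDeriv_nonneg _)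
  have hf1 : ∀ w, f w ≤ 1 := fun w =>
    mul_le_one₀ (reluDeriv_le_one _) (reluDeriv_nonneg _) (reluDeriv_le_one _)
  have hfm : Measurable f := by fun_prop
  have hfL : MemLp f 2 (gaussianVec d ν) :=
    memLp_of_bounded (ae_of_all _ fun w => ⟨hf0 w, hf1 w⟩) hfm.aestronglyMeasurable 2
  have hvar : Var[f; gaussianVec d ν] ≤ 1 := by
    refine (variance_le_sq_of_bounded (ae_of_all _ fun w => ⟨hf0 w, hf1 w⟩)
      hfm.aemeasurable).trans (by norm_num)
  set F : (Fin m → Fin d → ℝ) → ℝ := ∑ r, fun w => f (w r) with hF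
  have hFL : MemLp F 2 (Measure.pi fun _ : Fin m => gaussianVec d ν) :=
    memLp_finsetSum' _ fun r _ => hfL.comp_measurePreserving (measurePreserving_weight r)
  have hFvar : Var[F; Measure.pi fun _ : Fin m => gaussianVec d ν] ≤ m := by
    rw [hF, variance_sum_pi fun _ => hfL]
    refine (Finset.sum_le_sum fun _ _ => hvar).trans_eq (by simp)
  have hFmean : ∫ w, F w ∂(Measure.pi fun _ : Fin m => gaussianVec d ν)
      = m * limitGramS X ν i j := by
    simp only [hF, Finset.sum_apply]
    refine (integral_finsetSum _ fun r _ =>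
      (hfL.comp_measurePreserving (measurePreserving_weight r)).integrable (by norm_num)).trans ?_
    have : ∀ r : Fin m, ∫ w : Fin m → Fin d → ℝ, f (w r)
        ∂(Measure.pi fun _ : Fin m => gaussianVec d ν) = limitGramS X ν i j := fun r =>
      integral_comp_eval (μ := fun _ : Fin m => gaussianVec d ν) (f := f) (by fun_prop)
    exact (Finset.sum_congr rfl fun r _ => this r).trans (by simp)
  have hG : ∀ w : Fin m → Fin d → ℝ, (empGram X w i j - limitGramS X ν i j) ^ 2
      = 1 / (m : ℝ) ^ 2 * (F w - m * limitGramS X ν i j) ^ 2 := by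
    intro w
    have : empGram X w i j = 1 / m * F w := by
      simp only [empGram, Matrix.of_apply, hF, Finset.sum_apply, hf]
    rw [this]
    field_simp
  have hint : Integrable (fun w : Fin m → Fin d → ℝ => (empGram X w i j - limitGramS X ν i j) ^ 2)
      (Measure.pi fun _ : Fin m => gaussianVec d ν) := by
    simp only [hG]
    exact (hFL.sub (memLp_const _)).integrable_sq.const_mul _
  refine ⟨measurePreserving_weights.integrable_comp_of_integrable hint, ?_⟩
  refine (integral_comp_measurePreserving measurePreserving_weights
    hint.aestronglyMeasurable).trans_le ?_
  simp only [hG]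
  rw [integral_const_mul, ← hFmean, ← variance_eq_integral hFL.aestronglyMeasurable.aemeasurable]
  calc _ ≤ 1 / (m : ℝ) ^ 2 * m := mul_le_mul_of_nonneg_left hFvar (by positivity)
    _ = 1 / m := by field_simp

theorem integral_sum_empGram_sub_sq_le (hm : 0 < m) :
    Integrable (fun ω : (Fin m → Fin d → ℝ) × (Fin m → ℝ) =>
        ∑ i, ∑ j, (empGram X ω.1 i j - limitGramS X ν i j) ^ 2) (initLaw m d ν) ∧
      ∫ ω, ∑ i, ∑ j, (empGram X ω.1 i j - limitGramS X ν i j) ^ 2 ∂(initLaw m d ν)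
        ≤ (n : ℝ) ^ 2 / m := by
  have hint : ∀ i j, Integrable (fun ω : (Fin m → Fin d → ℝ) × (Fin m → ℝ) =>
      (empGram X ω.1 i j - limitGramS X ν i j) ^ 2) (initLaw m d ν) := fun i j =>
    (integral_empGram_sub_sq_le hm i j).1
  refine ⟨integrable_finsetSum _ fun i _ => integrable_finsetSum _ fun j _ => hint i j, ?_⟩
  rw [integral_finsetSum _ fun i _ => integrable_finsetSum _ fun j _ => hint i j]
  calc _ ≤ ∑ _i : Fin n, ∑ _j : Fin n, 1 / (m : ℝ) := by
        refine Finset.sum_le_sum fun i _ => ?_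
        rw [integral_finsetSum _ fun j _ => hint i j]
        exact Finset.sum_le_sum fun j _ => (integral_empGram_sub_sq_le hm i j).2
    _ = (n : ℝ) ^ 2 / m := by simp; ring

/-- The smallest eigenvalue moves by at most the Frobenius distance of the two matrices. -/
theorem empGram_lower_bound [NeZero n] {w : Fin m → Fin d → ℝ}
    (hpos : 0 < lambdaMin (limitGramS X ν))
    (h : ∑ i, ∑ j, (empGram X w i j - limitGramS X ν i j) ^ 2
      ≤ lambdaMin (limitGramS X ν) ^ 2 / 4) (v : Fin n → ℝ) :
    lambdaMin (limitGramS X ν) / 2 * (v ⬝ᵥ v) ≤ v ⬝ᵥ (empGram X w *ᵥ v) := by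
  set lam := lambdaMin (limitGramS X ν)
  set D := empGram X w - limitGramS X ν with hD
  have h1 := lambdaMin_mul_le (isHermitian_limitGramS (X := X) (ν := ν)) v
  have h2 : (v ⬝ᵥ (D *ᵥ v)) ^ 2 ≤ (lam / 2 * (v ⬝ᵥ v)) ^ 2 := by
    have h3 : (D *ᵥ v) ⬝ᵥ (D *ᵥ v) ≤ lam ^ 2 / 4 * (v ⬝ᵥ v) := by
      rw [dotProduct_self_eq_sum_sq (D *ᵥ v)]
      calc ∑ i, (D *ᵥ v) i ^ 2 ≤ ∑ i, (∑ j, D i j ^ 2) * (v ⬝ᵥ v) := by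
            refine Finset.sum_le_sum fun i _ => ?_
            rw [dotProduct_self_eq_sum_sq v]
            exact Finset.sum_mul_sq_le_sq_mul_sq Finset.univ (fun j => D i j) v
        _ ≤ _ := by
            rw [← Finset.sum_mul]
            exact mul_le_mul_of_nonneg_right h (dotProduct_self_nonneg' v)
    calc _ ≤ (v ⬝ᵥ v) * ((D *ᵥ v) ⬝ᵥ (D *ᵥ v)) := dotProduct_sq_le _ _
      _ ≤ (v ⬝ᵥ v) * (lam ^ 2 / 4 * (v ⬝ᵥ v)) :=
          mul_le_mul_of_nonneg_left h3 (dotProduct_self_nonneg' v)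
      _ = _ := by ring
  have h4 := (abs_le_of_sq_le_sq' h2 (by have := dotProduct_self_nonneg' v; positivity)).1
  have h5 : v ⬝ᵥ (D *ᵥ v) = v ⬝ᵥ (empGram X w *ᵥ v) - v ⬝ᵥ (limitGramS X ν *ᵥ v) := by
    rw [hD, Matrix.sub_mulVec, dotProduct_sub]
  linarith

end Initialization

/-! ### Convergence with high probability -/

/-- Markov's inequality with failure probability `δ / 3`. -/
theorem measureReal_lt_le_third {Ω : Type*} [MeasurableSpace Ω] {μ : Measure Ω}
    [IsFiniteMeasure μ] {f : Ω → ℝ} {b t δ : ℝ} (hf : ∀ ω, 0 ≤ f ω)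
    (h : Integrable f μ ∧ ∫ ω, f ω ∂μ ≤ b) (ht : 0 < t) (hb : b ≤ δ / 3 * t) :
    μ.real {ω | t < f ω} ≤ δ / 3 := by
  have h1 := mul_meas_ge_le_integral_of_nonneg (ae_of_all _ hf) h.1 t
  have h2 : μ.real {ω | t < f ω} ≤ μ.real {ω | t ≤ f ω} :=
    measureReal_mono fun ω (hω : t < f ω) => hω.le
  refine h2.trans (le_of_mul_le_mul_left ?_ ht)
  linarith [h.2]

/-- Three events of probability at most `δ / 3` and a null event are avoided simultaneously with
probability at least `1 - δ`. No measurability of `G` is needed. -/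
theorem ofReal_one_sub_le_of_three_events {Ω : Type*} [MeasurableSpace Ω] {μ : Measure Ω}
    [IsProbabilityMeasure μ] {δ : ℝ} {s₁ s₂ s₃ G : Set Ω} {p : Ω → Prop} (h₁ : μ.real s₁ ≤ δ / 3)
    (h₂ : μ.real s₂ ≤ δ / 3) (h₃ : μ.real s₃ ≤ δ / 3) (hp : ∀ᵐ ω ∂μ, p ω)
    (hG : ∀ ω, p ω → ω ∉ s₁ → ω ∉ s₂ → ω ∉ s₃ → ω ∈ G) : ENNReal.ofReal (1 - δ) ≤ μ G := by
  have hcover : (Set.univ : Set Ω) ⊆ G ∪ (s₁ ∪ s₂ ∪ s₃ ∪ {ω | ¬ p ω}) := by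
    intro ω _
    by_contra h
    simp only [Set.mem_union, not_or, Set.mem_ofPred_eq, not_not] at h
    exact h.1 (hG ω h.2.2 h.2.1.1.1 h.2.1.1.2 h.2.1.2)
  have hnull : μ.real {ω | ¬ p ω} = 0 := by
    rw [measureReal_def, ae_iff.1 hp, ENNReal.toReal_zero]
  have h : (1 : ℝ) ≤ μ.real G + δ := by
    calc (1 : ℝ) = μ.real Set.univ := probReal_univ.symm
      _ ≤ μ.real (G ∪ (s₁ ∪ s₂ ∪ s₃ ∪ {ω | ¬ p ω})) := measureReal_mono hcover
      _ ≤ μ.real G + μ.real (s₁ ∪ s₂ ∪ s₃ ∪ {ω | ¬ p ω}) := measureReal_union_le _ _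
      _ ≤ μ.real G + (μ.real s₁ + μ.real s₂ + μ.real s₃ + μ.real {ω | ¬ p ω}) := by
          gcongr
          refine (measureReal_union_le _ _).trans ?_
          gcongr
          refine (measureReal_union_le _ _).trans ?_
          gcongr
          exact measureReal_union_le _ _
      _ ≤ μ.real G + δ := by rw [hnull]; linarith
  rw [← ofReal_measureReal (measure_ne_top μ G)]
  exact ENNReal.ofReal_le_ofReal (by linarith)

/-- K-FAC converges when the width `m` satisfies the two lower bounds that the proof uses: `hm₁` for
the concentration of the Gram matrix of the activation patterns, `hm₂` for the stability of these
patterns along the trajectory. The threshold `R` for small pre-activations and the bound `T` on the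
squared initial residual are those for which Markov's inequality leaves the failure probability
`δ / 3`. -/
theorem kfacIter_converges_of_width {n d m : ℕ} [NeZero n] [NeZero d]
    {X : Matrix (Fin n) (Fin d) ℝ} {y : Fin n → ℝ} {ν δ η B R T l L lam : ℝ}
    (hl : l = lambdaMin (Xᵀ * X)) (hL : L = lambdaMax (Xᵀ * X))
    (hlam : lam = lambdaMin (limitGramS X ν)) (hlpos : 0 < l) (hlampos : 0 < lam)
    (hi : ∀ i, X i ⬝ᵥ X i = 1) (hy : ∀ i, |y i| ≤ B)
    (hν : 0 < ν) (hδ : 0 < δ) (hη : 0 < η) (hη' : η ≤ 1 / 4 * l) (hm : 0 < m)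
    (hR : R = δ * (lam * l / (256 * L)) * ν / (3 * n))
    (hT : T = 6 * n * (ν ^ 2 + B ^ 2) / δ)
    (hm₁ : 12 * (n : ℝ) ^ 2 ≤ m * (δ * lam ^ 2))
    (hm₂ : 16 * L / lam * T ≤ lam * l / (256 * L) * (m * R ^ 2)) :
    ENNReal.ofReal (1 - δ) ≤ initLaw m d ν
      {ω | ∀ k : ℕ, ‖WithLp.toLp 2 (output X ω.2 (kfacIter X y ω.2 η ω.1 k) - y)‖ ^ 2
        ≤ (1 - η / L) ^ k * ‖WithLp.toLp 2 (output X ω.2 ω.1 - y)‖ ^ 2} := by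
  have hm' : (0 : ℝ) < m := Nat.cast_pos.2 hm
  have hn' : (0 : ℝ) < n := Nat.cast_pos.2 (NeZero.pos n)
  have hlL : l ≤ L := by
    rw [hl, hL]; exact lambdaMin_le_lambdaMax (isHermitian_transpose_mul_self X)
  have hLpos : 0 < L := hlpos.trans_le hlL
  have hX : IsUnit (Xᵀ * X).det :=
    (dotProduct_inv_mulVec_le (hl ▸ hlpos) (lambdaMin_mul_le (isHermitian_transpose_mul_self X))).1
  have hRpos : 0 < R := by rw [hR]; positivity
  have hTpos : 0 < T := by rw [hT]; positivity
  -- Half of the flip rate that `kfacIter_converges` tolerates: one half for the units with a small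
  -- initial pre-activation, one half for those that move far.
  set ρ := lam * l / (256 * L) with hρ
  have hρpos : 0 < ρ := by positivity
  have hB₁ : (initLaw m d ν).real {ω | ρ * m < nearCount X R ω.1} ≤ δ / 3 := by
    refine measureReal_lt_le_third (fun ω => ?_) (integral_nearCount_le hν hi hRpos.le)
      (by positivity) (le_of_eq ?_)
    · exact Finset.sum_nonneg fun i _ => Finset.sum_nonneg fun r _ => by split_ifs <;> norm_num
    · rw [hR]; field_simp
  have hB₂ : (initLaw m d ν).real
      {ω | T < 2 * (∑ i, output X ω.2 ω.1 i ^ 2) + 2 * (∑ i, y i ^ 2)} ≤ δ / 3 := by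
    refine measureReal_lt_le_third (fun ω => by positivity) (integral_residual_le hi hy) hTpos
      (le_of_eq ?_)
    rw [hT]; field_simp; norm_num
  have hB₃ : (initLaw m d ν).real
      {ω | lam ^ 2 / 4 < ∑ i, ∑ j, (empGram X ω.1 i j - limitGramS X ν i j) ^ 2} ≤ δ / 3 := by
    refine measureReal_lt_le_third (fun ω => by positivity) (integral_sum_empGram_sub_sq_le hm)
      (by positivity) ?_
    rw [div_le_iff₀ hm']
    linarith
  refine ofReal_one_sub_le_of_three_events hB₁ hB₂ hB₃ ae_abs_eq_one_initLaw ?_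
  rintro ⟨w₀, a⟩ ha h₁ h₂ h₃
  simp only [Set.mem_ofPred_eq, not_lt] at ha h₁ h₂ h₃ ⊢
  have hS : ∀ v, lam / 2 * (v ⬝ᵥ v)
      ≤ ((preactDeriv X a w₀)ᵀ *ᵥ v) ⬝ᵥ ((preactDeriv X a w₀)ᵀ *ᵥ v) := by
    intro v
    rw [← dotProduct_transpose_mul_mulVec, Matrix.transpose_transpose, preactDeriv_mul_transpose ha,
      hlam]
    exact empGram_lower_bound (hlam ▸ hlampos) (hlam ▸ h₃) v
  have hE : ‖WithLp.toLp 2 (output X a w₀ - y)‖ ^ 2 ≤ T := by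
    refine le_trans ?_ h₂
    rw [norm_toLp_sq, dotProduct_self_eq_sum_sq, Finset.mul_sum, Finset.mul_sum,
      ← Finset.sum_add_distrib]
    refine Finset.sum_le_sum fun i _ => ?_
    rw [Pi.sub_apply]
    nlinarith [sq_nonneg (output X a w₀ i + y i)]
  rw [hL]
  refine kfacIter_converges (hl ▸ hlpos) hX hi ha hlampos hS hη (hl ▸ hη') fun w hw => ?_
  rw [← hL] at hw
  rw [← hl, ← hL]
  have hV : ‖preact X w - preact X w₀‖ ^ 2 ≤ ρ * (m * R ^ 2) := by
    calc ‖preact X w - preact X w₀‖ ^ 2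
        ≤ (4 * √L / √lam * ‖WithLp.toLp 2 (output X a w₀ - y)‖) ^ 2 :=
          pow_le_pow_left₀ (norm_nonneg _) hw 2
      _ = 16 * L / lam * ‖WithLp.toLp 2 (output X a w₀ - y)‖ ^ 2 := by
          rw [mul_pow, div_pow, mul_pow, Real.sq_sqrt hLpos.le, Real.sq_sqrt hlampos.le]
          norm_num
      _ ≤ 16 * L / lam * T := mul_le_mul_of_nonneg_left hE (by positivity)
      _ ≤ _ := hm₂
  calc flipRate X w₀ w
      ≤ nearCount X R w₀ / m + ‖preact X w - preact X w₀‖ ^ 2 / (m * R ^ 2) :=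
        flipRate_le w₀ w hRpos
    _ ≤ ρ + ρ := by
        refine add_le_add ?_ ?_
        · rwa [div_le_iff₀ hm']
        · rwa [div_le_iff₀ (by positivity)]
    _ = lam * l / (128 * L) := by rw [hρ]; field_simp; norm_num

/-- The width bound of the theorem implies the two bounds that the proof uses. Here `L ≤ n` is what
turns `n³ L⁴ / l³` into at most `n⁴ (L / l)⁴`. -/
theorem width_bounds {n m ν ν₀ δ l L lam B C : ℝ} (hn : 1 ≤ n) (hl : 0 < l) (hlL : l ≤ L)
    (hLn : L ≤ n) (hlam : 0 < lam) (hlam1 : lam ≤ 1) (hν : 0 < ν) (hν₀ : ν ≤ ν₀) (hδ : 0 < δ)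
    (hδ1 : δ < 1) (hC : C = 16 * 256 * 6 * 768 ^ 2 * (ν₀ ^ 2 + B ^ 2))
    (hm : C * (n ^ 4 * (L / l) ^ 4 / (ν ^ 2 * lam ^ 4 * δ ^ 3)) ≤ m) :
    12 * n ^ 2 ≤ m * (δ * lam ^ 2) ∧
      16 * L / lam * (6 * n * (ν ^ 2 + B ^ 2) / δ)
        ≤ lam * l / (256 * L) * (m * (δ * (lam * l / (256 * L)) * ν / (3 * n)) ^ 2) := by
  have hLpos : 0 < L := hl.trans_le hlL
  have hnpos : 0 < n := one_pos.trans_le hn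
  have hκ : 1 ≤ L / l := (one_le_div hl).2 hlL
  have hνν : ν ^ 2 ≤ ν₀ ^ 2 := pow_le_pow_left₀ hν.le hν₀ 2
  have hden : 0 < ν ^ 2 * lam ^ 4 * δ ^ 3 := by positivity
  rw [← mul_div_assoc, div_le_iff₀ hden] at hm
  constructor
  · have h1 : 12 * n ^ 2 * ν ^ 2 ≤ C * (n ^ 4 * (L / l) ^ 4) := by
      calc 12 * n ^ 2 * ν ^ 2 = 12 * ν ^ 2 * n ^ 2 := by ring
        _ ≤ C * n ^ 4 := by
            have hC12 : 12 * ν ^ 2 ≤ C := by rw [hC]; nlinarith [sq_nonneg B, sq_nonneg ν]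
            exact mul_le_mul hC12 (pow_le_pow_right₀ hn (by norm_num)) (by positivity)
              (le_trans (by positivity) hC12)
        _ ≤ C * (n ^ 4 * (L / l) ^ 4) := by
            refine mul_le_mul_of_nonneg_left ?_ (by rw [hC]; positivity)
            exact le_mul_of_one_le_right (by positivity) (one_le_pow₀ hκ)
    have hm0 : 0 ≤ m := by
      have : 0 ≤ m * (ν ^ 2 * lam ^ 4 * δ ^ 3) :=
        le_trans (mul_nonneg (by rw [hC]; positivity) (by positivity)) hm
      exact nonneg_of_mul_nonneg_left this hden
    have h2 : m * (ν ^ 2 * lam ^ 4 * δ ^ 3) ≤ m * (δ * lam ^ 2) * ν ^ 2 := by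
      have h3 : lam ^ 2 * δ ^ 2 ≤ 1 :=
        mul_le_one₀ (pow_le_one₀ hlam.le hlam1) (by positivity) (pow_le_one₀ hδ.le hδ1.le)
      calc m * (ν ^ 2 * lam ^ 4 * δ ^ 3) = m * (δ * lam ^ 2) * ν ^ 2 * (lam ^ 2 * δ ^ 2) := by ring
        _ ≤ _ := mul_le_of_le_one_right (by positivity) h3
    exact le_of_mul_le_mul_right ((h1.trans hm).trans h2) (by positivity)
  · have hl' : l ≤ n := hlL.trans hLn
    have h1 : 16 * 256 * 6 * 768 ^ 2 * (ν ^ 2 + B ^ 2) * (n ^ 3 * L ^ 4)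
        ≤ m * (ν ^ 2 * lam ^ 4 * δ ^ 3) * l ^ 3 := by
      calc 16 * 256 * 6 * 768 ^ 2 * (ν ^ 2 + B ^ 2) * (n ^ 3 * L ^ 4)
          ≤ C * (n ^ 3 * L ^ 4) := by
            refine mul_le_mul_of_nonneg_right ?_ (by positivity)
            rw [hC]; gcongr
        _ = C * (n ^ 3 * (L / l) ^ 4 * l) * l ^ 3 := by field_simp
        _ ≤ C * (n ^ 4 * (L / l) ^ 4) * l ^ 3 := by
            refine mul_le_mul_of_nonneg_right (mul_le_mul_of_nonneg_left ?_
              (by rw [hC]; positivity)) (by positivity)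
            calc n ^ 3 * (L / l) ^ 4 * l ≤ n ^ 3 * (L / l) ^ 4 * n :=
                  mul_le_mul_of_nonneg_left hl' (by positivity)
              _ = _ := by ring
        _ ≤ _ := mul_le_mul_of_nonneg_right hm (by positivity)
    calc 16 * L / lam * (6 * n * (ν ^ 2 + B ^ 2) / δ)
        = 16 * 256 * 6 * 768 ^ 2 * (ν ^ 2 + B ^ 2) * (n ^ 3 * L ^ 4)
            / (256 * 768 ^ 2 * n ^ 2 * L ^ 3 * lam * δ) := by field_simp
      _ ≤ m * (ν ^ 2 * lam ^ 4 * δ ^ 3) * l ^ 3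
            / (256 * 768 ^ 2 * n ^ 2 * L ^ 3 * lam * δ) :=
          div_le_div_of_nonneg_right h1 (by positivity)
      _ = _ := by field_simp; ring

end KFAC

theorem mainTheorem3 :
    ∃ c : ℝ, 0 < c ∧ ∀ B ν₀ : ℝ, 0 < B → 0 < ν₀ → ∃ C : ℝ, 0 < C ∧
      ∀ (n d m : ℕ) (X : Matrix (Fin n) (Fin d) ℝ) (y : Fin n → ℝ) (ν δ η : ℝ),
        1 ≤ n →
        (∀ i, ‖WithLp.toLp 2 (X i)‖ = 1) →
        (∀ i, |y i| ≤ B) →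
        (∀ i j, i ≠ j → ∀ t : ℝ, X i ≠ t • X j) →
        X.rank = d →
        0 < ν → ν ≤ ν₀ →
        0 < δ → δ < 1 →
        C * ((n : ℝ) ^ 4 * KFAC.conditionNumber (Xᵀ * X) ^ 4
          / (ν ^ 2 * KFAC.lambdaMin (KFAC.limitGramS X ν) ^ 4 * δ ^ 3)) ≤ (m : ℝ) →
        0 < η → η ≤ c * KFAC.lambdaMin (Xᵀ * X) →
        ENNReal.ofReal (1 - δ) ≤ KFAC.initLaw m d ν
          {ω | ∀ k : ℕ,
            ‖WithLp.toLp 2 (KFAC.output X ω.2 (KFAC.kfacIter X y ω.2 η ω.1 k) - y)‖ ^ 2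
              ≤ (1 - η / KFAC.lambdaMax (Xᵀ * X)) ^ k
                * ‖WithLp.toLp 2 (KFAC.output X ω.2 ω.1 - y)‖ ^ 2} := by
  refine ⟨1 / 4, by norm_num, fun B ν₀ hB hν₀ =>
    ⟨16 * 256 * 6 * 768 ^ 2 * (ν₀ ^ 2 + B ^ 2), by positivity, ?_⟩⟩
  intro n d m X y ν δ η hn hX hy hpar hrank hν hνν₀ hδ hδ1 hm hη hη'
  have : NeZero n := ⟨by omega⟩
  have hi : ∀ i, X i ⬝ᵥ X i = 1 := fun i => by rw [← KFAC.norm_toLp_sq, hX, one_pow]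
  -- A unit vector has at least one coordinate.
  have : NeZero d := ⟨by
    rintro rfl
    simpa [dotProduct] using hi 0⟩
  have hlpos := KFAC.lambdaMin_transpose_mul_self_pos hrank
  have hlampos := KFAC.lambdaMin_limitGramS_pos hν hi hpar
  obtain ⟨hm₁, hm₂⟩ := KFAC.width_bounds (by exact_mod_cast hn) hlpos
    (KFAC.lambdaMin_le_lambdaMax (KFAC.isHermitian_transpose_mul_self X))
    (KFAC.lambdaMax_transpose_mul_self_le hi) hlampos KFAC.lambdaMin_limitGramS_le_one hν hνν₀ hδ
    hδ1 rfl hm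
  have hm0 : 0 < m := by
    by_contra! h
    have hn' : (1 : ℝ) ≤ n := by exact_mod_cast hn
    rw [Nat.le_zero.1 h, Nat.cast_zero, zero_mul] at hm₁
    nlinarith
  exact KFAC.kfacIter_converges_of_width rfl rfl rfl hlpos hlampos hi hy hν hδ hη hη' hm0 rfl rfl
    hm₁ hm₂
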